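/- For $\varepsilon>0$ let $\Omega=\Omega_\varepsilon=(-\tfrac12\varepsilon^{-1/2},\tfrac12\varepsilon^{-1/2})^2\subset\mathbb R^2$, with points $(x,y)$, and put \[ X=X_\varepsilon=\Bigl\{\psi\in H^2(\Omega):\ \psi_x=0 \text{ at } x=\pm\tfrac12\varepsilon^{-1/2},\ \psi \text{ is } \varepsilon^{-1/2}\text{-periodic in } y,\ \int_\Omega\psi=0\Bigr\}, \] where the boundary conditions are understood in the sense of traces (periodicity in $y$ meaning that $\psi$ and $\psi_y$ each have equal traces at $y=\pm\tfrac12\varepsilon^{-1/2}$). With $[a,b]=\tfrac12a_{xx}b_{yy}+\tfrac12a_{yy}b_{xx}-a_{xy}b_{xy}$, let $\phi\in H^2(\Omega)$ be the weak solution, unique up to an additive constant, of \[ \Delta^2\phi+[w,w]+w_{xx}=0,\qquad \phi \text{ is periodic in } y,\qquad \phi_x=(\Delta\phi)_x=0 \text{ at } x=\pm\tfrac12\varepsilon^{-1/2}, \] and for $w\in X$ and $\lambda\in\mathbb R$ define \[ E(w)=\tfrac12\int_\Omega\bigl((\Delta w)^2+(\Delta\phi)^2\bigr),\qquad S(w)=\tfrac12\int_\Omega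 w_x^2,\qquad F_\lambda(w)=E(w)-\lambda S(w). \] 1. For every $\lambda>0$ there is $\varepsilon_0>0$ such that for every $\varepsilon\in(0,\varepsilon_0)$ there exists $w\in X_\varepsilon$ with $F_\lambda(w)<0$. 2. There is $\varepsilon_0>0$ such that for every $\varepsilon\in(0,\varepsilon_0)$ there exists $\lambda_0=\lambda_0(\varepsilon)\in[0,2)$ such that for all $\lambda>\lambda_0$ there exists $w\in X_\varepsilon$ with $F_\lambda(w)<0$. -/

import Mathlib

open MeasureTheory
open scoped ContDiff

namespace VKD

noncomputable section

/-- The side length `ε^{-1/2}` of the rescaled domain. -/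
def side (ε : ℝ) : ℝ := ε ^ (-(1 / 2) : ℝ)

/-- The rescaled domain `Ω = (-½ ε^{-1/2}, ½ ε^{-1/2}) × (-½ ε^{-1/2}, ½ ε^{-1/2})`. A point is
`(x, y)`, with `x` the axial and `y` the tangential (circumferential) coordinate. -/
def Omega (ε : ℝ) : Set (ℝ × ℝ) :=
  Set.Ioo (-(side ε / 2)) (side ε / 2) ×ˢ Set.Ioo (-(side ε / 2)) (side ε / 2)

/-- The unit vector in the `x` direction. -/
def ex : ℝ × ℝ := (1, 0)

/-- The unit vector in the `y` direction. -/
def ey : ℝ × ℝ := (0, 1)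

/-- The formula of integration by parts without boundary term,
`∫_U f ∂_v ζ = - ∫_U g ζ`, for all functions `ζ` of the class `T`. -/
def IntByParts (U : Set (ℝ × ℝ)) (T : (ℝ × ℝ → ℝ) → Prop) (v : ℝ × ℝ) (f g : ℝ × ℝ → ℝ) : Prop :=
  ∀ ζ : ℝ × ℝ → ℝ, T ζ → ∫ p in U, f p * fderiv ℝ ζ p v = -∫ p in U, g p * ζ p

/-- The functions in `C_c^∞(U)`. -/
def IsTestFunction (U : Set (ℝ × ℝ)) (ζ : ℝ × ℝ → ℝ) : Prop :=
  ContDiff ℝ ∞ ζ ∧ HasCompactSupport ζ ∧ tsupport ζ ⊆ U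

/-- The smooth functions on the plane. -/
def IsSmooth (ζ : ℝ × ℝ → ℝ) : Prop := ContDiff ℝ ∞ ζ

/-- The smooth functions on the plane that have period `ε^{-1/2}` in `y`. -/
def IsSmoothPeriodic (ε : ℝ) (ζ : ℝ × ℝ → ℝ) : Prop :=
  ContDiff ℝ ∞ ζ ∧ ∀ x y : ℝ, ζ (x, y + side ε) = ζ (x, y)

/-- `g` is the weak derivative of `f` on `U` in the direction `v`. -/
def HasWeakDeriv (U : Set (ℝ × ℝ)) (v : ℝ × ℝ) (f g : ℝ × ℝ → ℝ) : Prop :=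
  IntByParts U (IsTestFunction U) v f g

/-- An element of the Sobolev space `H²(U)`: a square integrable function on `U` together with its
weak first and second derivatives, which are square integrable as well. The derivatives are
determined almost everywhere on `U` by the function. -/
structure SobolevH2 (U : Set (ℝ × ℝ)) where
  val : ℝ × ℝ → ℝ
  dx : ℝ × ℝ → ℝ
  dy : ℝ × ℝ → ℝ
  dxx : ℝ × ℝ → ℝ
  dxy : ℝ × ℝ → ℝ
  dyy : ℝ × ℝ → ℝ
  memLp_val : MemLp val 2 (volume.restrict U)
  memLp_dx : MemLp dx 2 (volume.restrict U)
  memLp_dy : MemLp dy 2 (volume.restrict U)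
  memLp_dxx : MemLp dxx 2 (volume.restrict U)
  memLp_dxy : MemLp dxy 2 (volume.restrict U)
  memLp_dyy : MemLp dyy 2 (volume.restrict U)
  weak_dx : HasWeakDeriv U ex val dx
  weak_dy : HasWeakDeriv U ey val dy
  weak_dxx : HasWeakDeriv U ex dx dxx
  weak_dxy : HasWeakDeriv U ey dx dxy
  weak_dyy : HasWeakDeriv U ey dy dyy

/-- The Laplacian. -/
def SobolevH2.lap {U : Set (ℝ × ℝ)} (u : SobolevH2 U) (p : ℝ × ℝ) : ℝ := u.dxx p + u.dyy p

/-- The bracket `[a, b] = ½ a_xx b_yy + ½ a_yy b_xx - a_xy b_xy`. -/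
def bracket {U : Set (ℝ × ℝ)} (a b : SobolevH2 U) (p : ℝ × ℝ) : ℝ :=
  1 / 2 * (a.dxx p * b.dyy p) + 1 / 2 * (a.dyy p * b.dxx p) - a.dxy p * b.dxy p

/-- `u_x = 0` at the two ends `x = ± ½ ε^{-1/2}`, in the sense of traces. By Green's formula,
`∫_Ω (u_x ζ_x + u_xx ζ)` is the integral of `u_x ζ` over the end `x = ½ ε^{-1/2}` minus that over
the end `x = -½ ε^{-1/2}`; it vanishes for all smooth `ζ` if and only if the trace of `u_x` is zero
on both ends. -/
def ZeroSlopeAtEnds {ε : ℝ} (u : SobolevH2 (Omega ε)) : Prop :=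
  IntByParts (Omega ε) IsSmooth ex u.dx u.dxx

/-- `u` is periodic in `y` with period `ε^{-1/2}`, as an `H²` function: `u` and `u_y` have the same
traces on the two sides `y = ± ½ ε^{-1/2}`. By Green's formula, `∫_Ω (u ζ_y + u_y ζ)` with a
periodic `ζ` is the integral of `(u(x, ½ ε^{-1/2}) - u(x, -½ ε^{-1/2})) ζ(x, ½ ε^{-1/2})` over `x`,
and likewise for `u_y`. -/
def PeriodicInY {ε : ℝ} (u : SobolevH2 (Omega ε)) : Prop :=
  IntByParts (Omega ε) (IsSmoothPeriodic ε) ey u.val u.dy ∧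
    IntByParts (Omega ε) (IsSmoothPeriodic ε) ey u.dy u.dyy

/-- Membership in the space
`X = {ψ ∈ H²(Ω) : ψ_x(±½ ε^{-1/2}, ·) = 0, ψ is periodic in y, ∫_Ω ψ = 0}`. -/
def MemX {ε : ℝ} (w : SobolevH2 (Omega ε)) : Prop :=
  ZeroSlopeAtEnds w ∧ PeriodicInY w ∧ ∫ p in Omega ε, w.val p = 0

/-- `φ` is a weak solution of `Δ²φ + [w, w] + w_xx = 0` that is periodic in `y` and has
`φ_x = (Δφ)_x = 0` at the ends `x = ± ½ ε^{-1/2}`. The conditions of first order on `φ` are imposed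
on `φ` and on the test functions; `(Δφ)_x = 0` and the periodicity of the higher derivatives are the
natural boundary conditions of the variational formulation. -/
def IsAiryStress {ε : ℝ} (w φ : SobolevH2 (Omega ε)) : Prop :=
  ZeroSlopeAtEnds φ ∧ PeriodicInY φ ∧
    ∀ ζ : SobolevH2 (Omega ε), ZeroSlopeAtEnds ζ → PeriodicInY ζ →
      ∫ p in Omega ε, φ.lap p * ζ.lap p =
        -∫ p in Omega ε, (bracket w w p + w.dxx p) * ζ.val p

open Classical in
/-- The integral `∫_Ω (Δφ)²`, where `φ` is an Airy stress function of `w`. It does not depend on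
the choice of `φ`, see `stretching_eq` below. -/
def stretching {ε : ℝ} (w : SobolevH2 (Omega ε)) : ℝ :=
  if h : ∃ φ, IsAiryStress w φ then ∫ p in Omega ε, (h.choose.lap p) ^ 2 else 0

/-- The stored energy `E(w) = ½ ∫_Ω ((Δw)² + (Δφ)²)`. -/
def storedEnergy {ε : ℝ} (w : SobolevH2 (Omega ε)) : ℝ :=
  1 / 2 * ((∫ p in Omega ε, (w.lap p) ^ 2) + stretching w)

/-- The average axial shortening `S(w) = ½ ∫_Ω w_x²`. -/
def shortening {ε : ℝ} (w : SobolevH2 (Omega ε)) : ℝ :=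
  1 / 2 * ∫ p in Omega ε, (w.dx p) ^ 2

/-- The total potential `F_λ(w) = E(w) - λ S(w)`. -/
def totalPotential {ε : ℝ} (lam : ℝ) (w : SobolevH2 (Omega ε)) : ℝ :=
  storedEnergy w - lam * shortening w

/-! The stored energy is well defined: two Airy stress functions of `w` have the same Laplacian. -/

theorem Omega_subset (ε : ℝ) : Omega ε ⊆
    Set.Icc (-(side ε / 2)) (side ε / 2) ×ˢ Set.Icc (-(side ε / 2)) (side ε / 2) :=
  Set.prod_mono Set.Ioo_subset_Icc_self Set.Ioo_subset_Icc_self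

theorem volume_Omega_lt_top (ε : ℝ) : volume (Omega ε) < ⊤ :=
  (measure_mono (Omega_subset ε)).trans_lt (isCompact_Icc.prod isCompact_Icc).measure_lt_top

theorem measurableSet_Omega (ε : ℝ) : MeasurableSet (Omega ε) :=
  measurableSet_Ioo.prod measurableSet_Ioo

theorem integrable_mul {ε : ℝ} {f g : ℝ × ℝ → ℝ} (hf : MemLp f 2 (volume.restrict (Omega ε)))
    (hg : Continuous g) : IntegrableOn (fun p => f p * g p) (Omega ε) := by
  have : IsFiniteMeasure (volume.restrict (Omega ε)) :=
    ⟨by simpa using volume_Omega_lt_top ε⟩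
  have h1 : IntegrableOn f (Omega ε) := hf.integrable (by norm_num)
  exact h1.mul_continuousOn_of_subset hg.continuousOn (measurableSet_Omega ε)
    (isCompact_Icc.prod isCompact_Icc) (Omega_subset ε)

theorem IntByParts.sub {ε : ℝ} {T : (ℝ × ℝ → ℝ) → Prop} (hT : ∀ ζ, T ζ → ContDiff ℝ ∞ ζ)
    {v : ℝ × ℝ} {f g f' g' : ℝ × ℝ → ℝ}
    (hf : MemLp f 2 (volume.restrict (Omega ε))) (hg : MemLp g 2 (volume.restrict (Omega ε)))
    (hf' : MemLp f' 2 (volume.restrict (Omega ε))) (hg' : MemLp g' 2 (volume.restrict (Omega ε)))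
    (h : IntByParts (Omega ε) T v f g) (h' : IntByParts (Omega ε) T v f' g') :
    IntByParts (Omega ε) T v (fun p => f p - f' p) (fun p => g p - g' p) := by
  intro ζ hζ
  have hs := hT ζ hζ
  have hd : Continuous (fun p => fderiv ℝ ζ p v) :=
    (hs.continuous_fderiv (by simp)).clm_apply continuous_const
  simp only [sub_mul]
  rw [integral_sub (integrable_mul hf hd) (integrable_mul hf' hd),
    integral_sub (integrable_mul hg hs.continuous) (integrable_mul hg' hs.continuous),
    h ζ hζ, h' ζ hζ]
  ring

/-- The difference of two elements of `H²(Ω)`. -/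
def SobolevH2.diff {ε : ℝ} (u v : SobolevH2 (Omega ε)) : SobolevH2 (Omega ε) where
  val p := u.val p - v.val p
  dx p := u.dx p - v.dx p
  dy p := u.dy p - v.dy p
  dxx p := u.dxx p - v.dxx p
  dxy p := u.dxy p - v.dxy p
  dyy p := u.dyy p - v.dyy p
  memLp_val := u.memLp_val.sub v.memLp_val
  memLp_dx := u.memLp_dx.sub v.memLp_dx
  memLp_dy := u.memLp_dy.sub v.memLp_dy
  memLp_dxx := u.memLp_dxx.sub v.memLp_dxx
  memLp_dxy := u.memLp_dxy.sub v.memLp_dxy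
  memLp_dyy := u.memLp_dyy.sub v.memLp_dyy
  weak_dx := IntByParts.sub (fun _ h => h.1) u.memLp_val u.memLp_dx v.memLp_val v.memLp_dx
    u.weak_dx v.weak_dx
  weak_dy := IntByParts.sub (fun _ h => h.1) u.memLp_val u.memLp_dy v.memLp_val v.memLp_dy
    u.weak_dy v.weak_dy
  weak_dxx := IntByParts.sub (fun _ h => h.1) u.memLp_dx u.memLp_dxx v.memLp_dx v.memLp_dxx
    u.weak_dxx v.weak_dxx
  weak_dxy := IntByParts.sub (fun _ h => h.1) u.memLp_dx u.memLp_dxy v.memLp_dx v.memLp_dxy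
    u.weak_dxy v.weak_dxy
  weak_dyy := IntByParts.sub (fun _ h => h.1) u.memLp_dy u.memLp_dyy v.memLp_dy v.memLp_dyy
    u.weak_dyy v.weak_dyy

theorem memLp_lap {U : Set (ℝ × ℝ)} (u : SobolevH2 U) : MemLp u.lap 2 (volume.restrict U) :=
  u.memLp_dxx.add u.memLp_dyy

theorem IsAiryStress.integral_lap_sq_eq {ε : ℝ} {w φ ψ : SobolevH2 (Omega ε)}
    (hφ : IsAiryStress w φ) (hψ : IsAiryStress w ψ) :
    ∫ p in Omega ε, (φ.lap p) ^ 2 = ∫ p in Omega ε, (ψ.lap p) ^ 2 := by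
  have hz : ZeroSlopeAtEnds (φ.diff ψ) :=
    IntByParts.sub (fun _ h => h) φ.memLp_dx φ.memLp_dxx ψ.memLp_dx ψ.memLp_dxx hφ.1 hψ.1
  have hp : PeriodicInY (φ.diff ψ) :=
    ⟨IntByParts.sub (fun _ h => h.1) φ.memLp_val φ.memLp_dy ψ.memLp_val ψ.memLp_dy
      hφ.2.1.1 hψ.2.1.1,
    IntByParts.sub (fun _ h => h.1) φ.memLp_dy φ.memLp_dyy ψ.memLp_dy ψ.memLp_dyy
      hφ.2.1.2 hψ.2.1.2⟩
  have e := (hφ.2.2 _ hz hp).trans (hψ.2.2 _ hz hp).symm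
  have hl : ∀ p, (φ.diff ψ).lap p = φ.lap p - ψ.lap p := fun p => by
    simp only [SobolevH2.lap, SobolevH2.diff]; ring
  have i1 : IntegrableOn (fun p => φ.lap p * (φ.diff ψ).lap p) (Omega ε) :=
    (memLp_lap φ).integrable_mul (memLp_lap _)
  have i2 : IntegrableOn (fun p => ψ.lap p * (φ.diff ψ).lap p) (Omega ε) :=
    (memLp_lap ψ).integrable_mul (memLp_lap _)
  have h0 : ∫ p in Omega ε, ((φ.diff ψ).lap p) ^ 2 = 0 := by
    rw [← sub_eq_zero, ← integral_sub i1 i2] at e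
    rw [← e]
    refine integral_congr_ae (Filter.Eventually.of_forall fun p => ?_)
    simp only [hl]; ring
  rw [integral_eq_zero_iff_of_nonneg (fun p => sq_nonneg _) (memLp_lap _).integrable_sq] at h0
  refine integral_congr_ae ?_
  filter_upwards [h0] with p hp
  have h1 : (φ.diff ψ).lap p = 0 := by simpa using hp
  rw [hl, sub_eq_zero] at h1
  rw [h1]

theorem stretching_eq {ε : ℝ} {w φ : SobolevH2 (Omega ε)} (hφ : IsAiryStress w φ) :
    stretching w = ∫ p in Omega ε, (φ.lap p) ^ 2 := by
  have h : ∃ φ, IsAiryStress w φ := ⟨φ, hφ⟩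
  rw [stretching, dif_pos h]
  exact h.choose_spec.integral_lap_sq_eq hφ

end

end VKD

namespace VKD

/-! ### Calculus on the rectangle -/

/-! The right-hand side `[w, w] + w_xx` is the determinant of the Hessian of `w + y²/2`. Hence
stretching costs nothing, formally, when `w + y²/2` is piecewise affine with `D²w + e_y ⊗ e_y`
concentrated on ridge lines in a suitable way. The Yoshimura diamond pattern does this: with `ξ =
μ(y - x)` and `η = μ(y + x)`, the ridges lie on `ξ ∈ 2πℤ`, `η ∈ 2πℤ` and `η - ξ ∈ 2πℤ`, and the
vanishing of the determinant becomes `δ(ξ)δ(η) = δ(η - ξ) · ½(δ(ξ) + δ(η))` for periodic Dirac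
masses.

Bending energy forces the ridges to be smoothed. The Dirac masses are replaced by trigonometric sums
with coefficients `(1 - n²/N²)₊`; everything is then a finite cosine sum, and the Airy function is
found mode by mode. The error `defect N n m` in the identity is bounded by `3(n + m)²/N²`, and `n +
m` is also the wave number in `y`, so dividing by the symbol of the Laplacian leaves coefficients of
`Δφ` of size at most `3/(μ²N²)`.

With `u = 1/μ`, the averages over `Ω` satisfy, up to constants: bending `≲ N`
(`integral_lap_pattern_sq_le`), stretching `≲ u⁴/N²` (`integral_lap_stress_sq_le`), shortening `≳
u²` (`le_integral_pattern_dx_sq`). The choice `N = u^{4/3}` balances the two energies at `u^{4/3}`,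
which is negligible against `λu²` for large `u`. A large `u` is available as soon as the rectangle
is large, that is, for small `ε`.

The second claim follows from the first at a single load below 2, since the total potential
decreases in `λ`. -/

theorem side_pos {ε : ℝ} (hε : 0 < ε) : 0 < side ε := Real.rpow_pos_of_pos hε _

theorem Continuous.integrableOn_Omega {ε : ℝ} {f : ℝ × ℝ → ℝ} (hf : Continuous f) :
    IntegrableOn f (Omega ε) :=
  (hf.continuousOn.integrableOn_compact (isCompact_Icc.prod isCompact_Icc)).mono_set
    (Omega_subset ε)

theorem Continuous.memLp_Omega {ε : ℝ} {f : ℝ × ℝ → ℝ} (hf : Continuous f) :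
    MemLp f 2 (volume.restrict (Omega ε)) := by
  have : IsFiniteMeasure (volume.restrict (Omega ε)) :=
    ⟨by simpa using volume_Omega_lt_top ε⟩
  obtain ⟨C, hC⟩ := (isCompact_Icc.prod isCompact_Icc :
    IsCompact (Set.Icc (-(side ε / 2)) (side ε / 2) ×ˢ
      Set.Icc (-(side ε / 2)) (side ε / 2))).exists_bound_of_continuousOn hf.continuousOn
  refine MemLp.of_bound hf.aestronglyMeasurable C ?_
  filter_upwards [ae_restrict_mem (measurableSet_Omega ε)] with p hp
  exact hC p (Omega_subset ε hp)

/-- An `x`-derivative with equal boundary values at the two ends has integral zero. -/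
theorem integral_deriv_fst_eq_zero {ε : ℝ} (hε : 0 < ε) {f g : ℝ × ℝ → ℝ} (hg : Continuous g)
    (hd : ∀ x y, HasDerivAt (fun t => f (t, y)) (g (x, y)) x)
    (hb : ∀ y, f (side ε / 2, y) = f (-(side ε / 2), y)) :
    ∫ p in Omega ε, g p = 0 := by
  have hs := side_pos hε
  have hi := Continuous.integrableOn_Omega (ε := ε) hg
  unfold Omega at hi ⊢
  rw [IntegrableOn, Measure.volume_eq_prod, ← Measure.prod_restrict] at hi
  rw [Measure.volume_eq_prod, ← Measure.prod_restrict, integral_prod_symm _ hi]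
  refine integral_eq_zero_of_ae (Filter.Eventually.of_forall fun y => ?_)
  simp only [Pi.zero_apply]
  rw [← integral_Ioc_eq_integral_Ioo, ← intervalIntegral.integral_of_le (by linarith),
    intervalIntegral.integral_eq_sub_of_hasDerivAt (f := fun t => f (t, y))
      (fun x _ => hd x y) (Continuous.intervalIntegrable (by fun_prop) _ _), hb, sub_self]

/-- A `y`-derivative with equal boundary values on the two sides has integral zero. -/
theorem integral_deriv_snd_eq_zero {ε : ℝ} (hε : 0 < ε) {f g : ℝ × ℝ → ℝ} (hg : Continuous g)
    (hd : ∀ x y, HasDerivAt (fun t => f (x, t)) (g (x, y)) y)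
    (hb : ∀ x, f (x, side ε / 2) = f (x, -(side ε / 2))) :
    ∫ p in Omega ε, g p = 0 := by
  have hs := side_pos hε
  have hi := Continuous.integrableOn_Omega (ε := ε) hg
  unfold Omega at hi ⊢
  rw [IntegrableOn, Measure.volume_eq_prod, ← Measure.prod_restrict] at hi
  rw [Measure.volume_eq_prod, ← Measure.prod_restrict, integral_prod _ hi]
  refine integral_eq_zero_of_ae (Filter.Eventually.of_forall fun x => ?_)
  simp only [Pi.zero_apply]
  rw [← integral_Ioc_eq_integral_Ioo, ← intervalIntegral.integral_of_le (by linarith),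
    intervalIntegral.integral_eq_sub_of_hasDerivAt (f := fun t => f (x, t))
      (fun y _ => hd x y) (Continuous.intervalIntegrable (by fun_prop) _ _), hb, sub_self]

theorem hasDerivAt_fst {ζ : ℝ × ℝ → ℝ} (h : ContDiff ℝ ∞ ζ) (x y : ℝ) :
    HasDerivAt (fun t => ζ (t, y)) (fderiv ℝ ζ (x, y) ex) x := by
  have h1 : HasDerivAt (fun t : ℝ => (t, y)) ex x := (hasDerivAt_id x).prodMk (hasDerivAt_const x y)
  exact ((h.differentiable (by simp)) (x, y)).hasFDerivAt.comp_hasDerivAt x h1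

theorem hasDerivAt_snd {ζ : ℝ × ℝ → ℝ} (h : ContDiff ℝ ∞ ζ) (x y : ℝ) :
    HasDerivAt (fun t => ζ (x, t)) (fderiv ℝ ζ (x, y) ey) y := by
  have h1 : HasDerivAt (fun t : ℝ => (x, t)) ey y := (hasDerivAt_const y x).prodMk (hasDerivAt_id y)
  exact ((h.differentiable (by simp)) (x, y)).hasFDerivAt.comp_hasDerivAt y h1

theorem continuous_fderiv_apply {ζ : ℝ × ℝ → ℝ} (h : ContDiff ℝ ∞ ζ) (v : ℝ × ℝ) :
    Continuous (fun p => fderiv ℝ ζ p v) :=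
  (h.continuous_fderiv (by simp)).clm_apply continuous_const

/-- Only the product with the test function has to match at the two ends. This covers compactly
supported test functions and a factor `f` that vanishes at the ends alike; the analogue in `y` also
covers periodicity. -/
theorem intByParts_ex {ε : ℝ} (hε : 0 < ε) {T : (ℝ × ℝ → ℝ) → Prop} {f g : ℝ × ℝ → ℝ}
    (hT : ∀ ζ, T ζ → ContDiff ℝ ∞ ζ) (hf : Continuous f) (hg : Continuous g)
    (hd : ∀ x y, HasDerivAt (fun t => f (t, y)) (g (x, y)) x)
    (hb : ∀ ζ, T ζ → ∀ y, f (side ε / 2, y) * ζ (side ε / 2, y) =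
      f (-(side ε / 2), y) * ζ (-(side ε / 2), y)) :
    IntByParts (Omega ε) T ex f g := by
  intro ζ hζ
  have hs := hT ζ hζ
  have hc := continuous_fderiv_apply hs ex
  have hz := hs.continuous
  have := integral_deriv_fst_eq_zero hε (f := fun p => f p * ζ p)
    (g := fun p => g p * ζ p + f p * fderiv ℝ ζ p ex) (by fun_prop)
    (fun x y => (hd x y).mul (hasDerivAt_fst hs x y)) (hb ζ hζ)
  rw [integral_add (Continuous.integrableOn_Omega (by fun_prop))
    (Continuous.integrableOn_Omega (by fun_prop))] at this
  linarith

theorem intByParts_ey {ε : ℝ} (hε : 0 < ε) {T : (ℝ × ℝ → ℝ) → Prop} {f g : ℝ × ℝ → ℝ}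
    (hT : ∀ ζ, T ζ → ContDiff ℝ ∞ ζ) (hf : Continuous f) (hg : Continuous g)
    (hd : ∀ x y, HasDerivAt (fun t => f (x, t)) (g (x, y)) y)
    (hb : ∀ ζ, T ζ → ∀ x, f (x, side ε / 2) * ζ (x, side ε / 2) =
      f (x, -(side ε / 2)) * ζ (x, -(side ε / 2))) :
    IntByParts (Omega ε) T ey f g := by
  intro ζ hζ
  have hs := hT ζ hζ
  have hc := continuous_fderiv_apply hs ey
  have hz := hs.continuous
  have := integral_deriv_snd_eq_zero hε (f := fun p => f p * ζ p)
    (g := fun p => g p * ζ p + f p * fderiv ℝ ζ p ey) (by fun_prop)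
    (fun x y => (hd x y).mul (hasDerivAt_snd hs x y)) (hb ζ hζ)
  rw [integral_add (Continuous.integrableOn_Omega (by fun_prop))
    (Continuous.integrableOn_Omega (by fun_prop))] at this
  linarith

theorem IsTestFunction.eq_zero {U : Set (ℝ × ℝ)} {ζ : ℝ × ℝ → ℝ} (h : IsTestFunction U ζ)
    {p : ℝ × ℝ} (hp : p ∉ U) : ζ p = 0 :=
  image_eq_zero_of_notMem_tsupport fun h' => hp (h.2.2 h')

theorem hasWeakDeriv_ex {ε : ℝ} (hε : 0 < ε) {f g : ℝ × ℝ → ℝ} (hf : Continuous f)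
    (hg : Continuous g) (hd : ∀ x y, HasDerivAt (fun t => f (t, y)) (g (x, y)) x) :
    HasWeakDeriv (Omega ε) ex f g :=
  intByParts_ex hε (fun _ h => h.1) hf hg hd fun ζ h y => by
    rw [h.eq_zero (by simp [Omega]), h.eq_zero (by simp [Omega])]; simp

theorem hasWeakDeriv_ey {ε : ℝ} (hε : 0 < ε) {f g : ℝ × ℝ → ℝ} (hf : Continuous f)
    (hg : Continuous g) (hd : ∀ x y, HasDerivAt (fun t => f (x, t)) (g (x, y)) y) :
    HasWeakDeriv (Omega ε) ey f g :=
  intByParts_ey hε (fun _ h => h.1) hf hg hd fun ζ h y => by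
    rw [h.eq_zero (by simp [Omega]), h.eq_zero (by simp [Omega])]; simp

/-! ### Cosine sums as elements of `H²` -/

section CosSum

variable {ι : Type*}

theorem hasDerivAt_cos_mul (a x : ℝ) :
    HasDerivAt (fun t => Real.cos (a * t)) (-a * Real.sin (a * x)) x := by
  have := (Real.hasDerivAt_cos (a * x)).comp x ((hasDerivAt_id x).const_mul a)
  exact this.congr_deriv (by ring)

theorem hasDerivAt_sin_mul (a x : ℝ) :
    HasDerivAt (fun t => Real.sin (a * t)) (a * Real.cos (a * x)) x := by
  have := (Real.hasDerivAt_sin (a * x)).comp x ((hasDerivAt_id x).const_mul a)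
  exact this.congr_deriv (by ring)

/-- The function `∑ i ∈ s, c i cos(a i x) cos(b i y)` as an element of `H²(Ω)`. -/
noncomputable def cosSum {ε : ℝ} (hε : 0 < ε) (s : Finset ι) (c a b : ι → ℝ) :
    SobolevH2 (Omega ε) where
  val p := ∑ i ∈ s, c i * (Real.cos (a i * p.1) * Real.cos (b i * p.2))
  dx p := ∑ i ∈ s, c i * ((-a i * Real.sin (a i * p.1)) * Real.cos (b i * p.2))
  dy p := ∑ i ∈ s, c i * (Real.cos (a i * p.1) * (-b i * Real.sin (b i * p.2)))
  dxx p := ∑ i ∈ s, c i * ((-a i * (a i * Real.cos (a i * p.1))) * Real.cos (b i * p.2))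
  dxy p := ∑ i ∈ s, c i * ((-a i * Real.sin (a i * p.1)) * (-b i * Real.sin (b i * p.2)))
  dyy p := ∑ i ∈ s, c i * (Real.cos (a i * p.1) * (-b i * (b i * Real.cos (b i * p.2))))
  memLp_val := Continuous.memLp_Omega (by fun_prop)
  memLp_dx := Continuous.memLp_Omega (by fun_prop)
  memLp_dy := Continuous.memLp_Omega (by fun_prop)
  memLp_dxx := Continuous.memLp_Omega (by fun_prop)
  memLp_dxy := Continuous.memLp_Omega (by fun_prop)
  memLp_dyy := Continuous.memLp_Omega (by fun_prop)
  weak_dx := hasWeakDeriv_ex hε (by fun_prop) (by fun_prop) fun x y =>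
    HasDerivAt.fun_sum fun i _ => ((hasDerivAt_cos_mul (a i) x).mul_const (Real.cos (b i * y))).const_mul (c i)
  weak_dy := hasWeakDeriv_ey hε (by fun_prop) (by fun_prop) fun x y =>
    HasDerivAt.fun_sum fun i _ => ((hasDerivAt_cos_mul (b i) y).const_mul (Real.cos (a i * x))).const_mul (c i)
  weak_dxx := hasWeakDeriv_ex hε (by fun_prop) (by fun_prop) fun x y =>
    HasDerivAt.fun_sum fun i _ =>
      (((hasDerivAt_sin_mul (a i) x).const_mul (-a i)).mul_const (Real.cos (b i * y))).const_mul (c i)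
  weak_dxy := hasWeakDeriv_ey hε (by fun_prop) (by fun_prop) fun x y =>
    HasDerivAt.fun_sum fun i _ => ((hasDerivAt_cos_mul (b i) y).const_mul
      (-a i * Real.sin (a i * x))).const_mul (c i)
  weak_dyy := hasWeakDeriv_ey hε (by fun_prop) (by fun_prop) fun x y =>
    HasDerivAt.fun_sum fun i _ =>
      (((hasDerivAt_sin_mul (b i) y).const_mul (-b i)).const_mul (Real.cos (a i * x))).const_mul (c i)

theorem lap_cosSum {ε : ℝ} (hε : 0 < ε) (s : Finset ι) (c a b : ι → ℝ) (p : ℝ × ℝ) :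
    (cosSum hε s c a b).lap p =
      ∑ i ∈ s, -(a i ^ 2 + b i ^ 2) * c i * (Real.cos (a i * p.1) * Real.cos (b i * p.2)) := by
  simp only [SobolevH2.lap, cosSum]
  rw [← Finset.sum_add_distrib]
  exact Finset.sum_congr rfl fun i _ => by ring

theorem zeroSlopeAtEnds_cosSum {ε : ℝ} (hε : 0 < ε) (s : Finset ι) (c a b : ι → ℝ)
    (ha : ∀ i, Real.sin (a i * (side ε / 2)) = 0) : ZeroSlopeAtEnds (cosSum hε s c a b) :=
  intByParts_ex hε (fun _ h => h) (by simp only [cosSum]; fun_prop)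
    (by simp only [cosSum]; fun_prop)
    (fun x y => HasDerivAt.fun_sum fun i _ =>
      (((hasDerivAt_sin_mul (a i) x).const_mul (-a i)).mul_const (Real.cos (b i * y))).const_mul (c i))
    fun ζ _ y => by simp [cosSum, ha]

/-- For the function, the two boundary values agree because cosine is even and the test function is
periodic. For its `y`-derivative they are both zero. -/
theorem periodicInY_cosSum {ε : ℝ} (hε : 0 < ε) (s : Finset ι) (c a b : ι → ℝ)
    (hb : ∀ i, Real.sin (b i * (side ε / 2)) = 0) : PeriodicInY (cosSum hε s c a b) := by
  constructor
  · refine intByParts_ey hε (fun _ h => h.1) (by simp only [cosSum]; fun_prop)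
      (by simp only [cosSum]; fun_prop)
      (fun x y => HasDerivAt.fun_sum fun i _ =>
        ((hasDerivAt_cos_mul (b i) y).const_mul (Real.cos (a i * x))).const_mul (c i)) fun ζ h x => ?_
    have := h.2 x (-(side ε / 2))
    rw [show -(side ε / 2) + side ε = side ε / 2 by ring] at this
    simp [cosSum, this]
  · refine intByParts_ey hε (fun _ h => h.1) (by simp only [cosSum]; fun_prop)
      (by simp only [cosSum]; fun_prop)
      (fun x y => HasDerivAt.fun_sum fun i _ =>
        (((hasDerivAt_sin_mul (b i) y).const_mul (-b i)).const_mul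
          (Real.cos (a i * x))).const_mul (c i)) fun ζ h x => ?_
    simp [cosSum, hb]

end CosSum

/-! ### Removal of the compact support in the weak derivative -/

/-- A cutoff of the interval `(-h, h)`. -/
noncomputable def cutoff (h : ℝ) (n : ℕ) (t : ℝ) : ℝ :=
  Real.smoothTransition (n * (h ^ 2 - t ^ 2) - 1)

theorem contDiff_cutoff (h : ℝ) (n : ℕ) : ContDiff ℝ ∞ (cutoff h n) :=
  Real.smoothTransition.contDiff.comp (by fun_prop)

theorem abs_cutoff_le_one (h : ℝ) (n : ℕ) (t : ℝ) : |cutoff h n t| ≤ 1 := by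
  rw [cutoff, abs_of_nonneg (Real.smoothTransition.nonneg _)]
  exact Real.smoothTransition.le_one _

/-- The transition is complete once `n(h² - t²) ≥ 2`. A whole neighbourhood of `t` is needed so that
the derivative of the cutoff at `t` vanishes too. -/
theorem eventually_cutoff_eq_one {h t : ℝ} (ht : t ∈ Set.Ioo (-h) h) :
    ∀ᶠ n : ℕ in Filter.atTop, ∀ᶠ u in nhds t, cutoff h n u = 1 := by
  have h0 : 0 < h ^ 2 - t ^ 2 := by nlinarith [ht.1, ht.2]
  filter_upwards [Filter.eventually_gt_atTop ⌈2 / (h ^ 2 - t ^ 2)⌉₊] with n hn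
  have h1 : 2 / (h ^ 2 - t ^ 2) < n := (Nat.le_ceil _).trans_lt (by exact_mod_cast hn)
  have h2 : 1 < n * (h ^ 2 - t ^ 2) - 1 := by
    rw [div_lt_iff₀ h0] at h1; linarith
  have h3 : Continuous fun u : ℝ => (n : ℝ) * (h ^ 2 - u ^ 2) - 1 := by fun_prop
  filter_upwards [h3.continuousAt.eventually (lt_mem_nhds h2)] with u hu
  exact Real.smoothTransition.one_of_one_le hu.le

theorem deriv_smoothTransition_eq_zero {u : ℝ} (hu : 1 < u) :
    deriv Real.smoothTransition u = 0 := by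
  have h : Real.smoothTransition =ᶠ[nhds u] fun _ => 1 :=
    (eventually_gt_nhds hu).mono fun v hv => Real.smoothTransition.one_of_one_le hv.le
  rw [h.deriv_eq, deriv_const]

theorem exists_deriv_smoothTransition_bound :
    ∃ C, ∀ u, |deriv Real.smoothTransition u| ≤ C := by
  have hc : Continuous (deriv Real.smoothTransition) :=
    (Real.smoothTransition.contDiff (n := 1)).continuous_deriv le_rfl
  refine (hc.bounded_above_of_compact_support
    (HasCompactSupport.intro (isCompact_Icc (a := (0 : ℝ)) (b := 1)) fun u hu => ?_))
  rw [Set.mem_Icc, not_and_or, not_le, not_le] at hu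
  rcases hu with hu | hu
  · have h : Real.smoothTransition =ᶠ[nhds u] fun _ => 0 :=
      (eventually_lt_nhds hu).mono fun v hv => Real.smoothTransition.zero_of_nonpos hv.le
    rw [h.deriv_eq, deriv_const]
  · exact deriv_smoothTransition_eq_zero hu

theorem deriv_cutoff (h : ℝ) (n : ℕ) (t : ℝ) :
    deriv (cutoff h n) t =
      deriv Real.smoothTransition (n * (h ^ 2 - t ^ 2) - 1) * (n * (-(2 * t))) := by
  have h1 : HasDerivAt (fun u : ℝ => (n : ℝ) * (h ^ 2 - u ^ 2) - 1) (n * (-(2 * t))) t := by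
    have := ((((hasDerivAt_id t).pow 2).const_sub (h ^ 2)).const_mul (n : ℝ)).sub_const 1
    simpa using this
  have h2 : DifferentiableAt ℝ Real.smoothTransition (n * (h ^ 2 - t ^ 2) - 1) :=
    (Real.smoothTransition.contDiff (n := 1)).differentiable (by simp) _
  exact (h2.hasDerivAt.comp t h1).deriv

/-- A factor that vanishes linearly at the ends compensates the derivative of the cutoff. -/
theorem exists_mul_deriv_cutoff_bound {h K : ℝ} (hh : 0 < h) (hK : 0 ≤ K) :
    ∃ C, ∀ (n : ℕ) (t g : ℝ), t ∈ Set.Ioo (-h) h → |g| ≤ K * (h ^ 2 - t ^ 2) →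
      |g * deriv (cutoff h n) t| ≤ C := by
  obtain ⟨C, hC⟩ := exists_deriv_smoothTransition_bound
  have hC0 : 0 ≤ C := (abs_nonneg _).trans (hC 0)
  refine ⟨K * C * (2 * (2 * h)), fun n t g ht hg => ?_⟩
  rw [deriv_cutoff]
  by_cases h1 : 1 < n * (h ^ 2 - t ^ 2) - 1
  · rw [deriv_smoothTransition_eq_zero h1]; simp; positivity
  -- Here `n(h² - t²) ≤ 2`, so the linear decay of `g` pays for the factor `n` in the derivative of
  -- the cutoff.
  · have ht' : |t| ≤ h := abs_le.2 ⟨ht.1.le, ht.2.le⟩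
    have h0 : 0 ≤ h ^ 2 - t ^ 2 := by nlinarith [ht.1, ht.2]
    have hn : (n : ℝ) * (h ^ 2 - t ^ 2) ≤ 2 := by linarith
    have e : |g * (deriv Real.smoothTransition (n * (h ^ 2 - t ^ 2) - 1) * (n * (-(2 * t))))| =
        |g| * |deriv Real.smoothTransition (n * (h ^ 2 - t ^ 2) - 1)| * (n * (2 * |t|)) := by
      simp [abs_mul, mul_assoc]
    rw [e]
    calc _ ≤ (K * (h ^ 2 - t ^ 2)) * C * (n * (2 * h)) := by gcongr; exact hC _
      _ = K * C * ((n * (h ^ 2 - t ^ 2)) * (2 * h)) := by ring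
      _ ≤ K * C * (2 * (2 * h)) := by gcongr

/-- The weak derivative may be tested with smooth functions that vanish linearly at the two ends,
without any condition in `y`. -/
theorem HasWeakDeriv.intByParts_of_vanishing {ε : ℝ} (hε : 0 < ε) {f f' : ℝ × ℝ → ℝ}
    (hf : MemLp f 2 (volume.restrict (Omega ε))) (hf' : MemLp f' 2 (volume.restrict (Omega ε)))
    (hw : HasWeakDeriv (Omega ε) ex f f') {g : ℝ × ℝ → ℝ} (hg : ContDiff ℝ ∞ g) {K : ℝ}
    (hK : 0 ≤ K) (hgK : ∀ p ∈ Omega ε, |g p| ≤ K * ((side ε / 2) ^ 2 - p.1 ^ 2)) :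
    ∫ p in Omega ε, f p * fderiv ℝ g p ex = -∫ p in Omega ε, f' p * g p := by
  set h := side ε / 2 with hh
  have h0 : 0 < h := by have := side_pos hε; positivity
  obtain ⟨C, hC⟩ := exists_mul_deriv_cutoff_bound h0 hK
  have hC0 : 0 ≤ C := (abs_nonneg _).trans (hC 0 0 0 ⟨by linarith, h0⟩ (by simp; positivity))
  have hχ : ∀ n, ContDiff ℝ ∞ fun p : ℝ × ℝ => cutoff h n p.1 * cutoff h n p.2 := fun n =>
    ((contDiff_cutoff h n).comp contDiff_fst).mul ((contDiff_cutoff h n).comp contDiff_snd)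
  have hT : ∀ n : ℕ, IsTestFunction (Omega ε)
      fun p => g p * (cutoff h n p.1 * cutoff h n p.2) := by
    intro n
    -- The support lies in the closed set where `n(h² - t²) ≥ 1` for both coordinates `t`, and this
    -- inequality forces `|t| < h`.
    have hz : Set.EqOn (fun p : ℝ × ℝ => g p * (cutoff h n p.1 * cutoff h n p.2)) 0
        {p | n * (h ^ 2 - p.1 ^ 2) - 1 ≤ 0 ∨ n * (h ^ 2 - p.2 ^ 2) - 1 ≤ 0} := by
      rintro p (hp | hp) <;> simp [cutoff, Real.smoothTransition.zero_of_nonpos hp]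
    have hcl : IsClosed ({p : ℝ × ℝ | 0 ≤ n * (h ^ 2 - p.1 ^ 2) - 1} ∩
        {p : ℝ × ℝ | 0 ≤ n * (h ^ 2 - p.2 ^ 2) - 1}) :=
      (isClosed_le (by fun_prop) (by fun_prop)).inter (isClosed_le (by fun_prop) (by fun_prop))
    have hsub : tsupport (fun p : ℝ × ℝ => g p * (cutoff h n p.1 * cutoff h n p.2)) ⊆
        {p : ℝ × ℝ | 0 ≤ n * (h ^ 2 - p.1 ^ 2) - 1} ∩
          {p : ℝ × ℝ | 0 ≤ n * (h ^ 2 - p.2 ^ 2) - 1} := by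
      refine closure_minimal (fun p hp => ?_) hcl
      by_contra hcon
      refine hp (hz ?_)
      simp only [Set.mem_inter_iff, Set.mem_ofPred_eq, not_and_or, not_le] at hcon ⊢
      exact hcon.imp le_of_lt le_of_lt
    have hlt : ∀ t : ℝ, 0 ≤ n * (h ^ 2 - t ^ 2) - 1 → t ∈ Set.Ioo (-h) h := by
      intro t ht
      have h1 : 0 < h ^ 2 - t ^ 2 := by
        by_contra hcon
        have : (n : ℝ) * (h ^ 2 - t ^ 2) ≤ 0 :=
          mul_nonpos_of_nonneg_of_nonpos (Nat.cast_nonneg n) (not_lt.1 hcon)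
        linarith
      exact abs_lt.1 (abs_lt_of_sq_lt_sq (by linarith) h0.le)
    have hsub' := hsub.trans fun p hp => (⟨hlt _ hp.1, hlt _ hp.2⟩ : p ∈ Omega ε)
    exact ⟨hg.mul (hχ n), (isCompact_Icc.prod isCompact_Icc).of_isClosed_subset
      (isClosed_tsupport _) (hsub'.trans (Omega_subset ε)), hsub'⟩
  -- The derivative is in the direction `ex`, so the cutoff in `y` is never differentiated; this is
  -- why no decay of `g` in `y` is needed.
  have hfd : ∀ (n : ℕ) (p : ℝ × ℝ),
      fderiv ℝ (fun p => g p * (cutoff h n p.1 * cutoff h n p.2)) p ex =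
        fderiv ℝ g p ex * (cutoff h n p.1 * cutoff h n p.2) +
          g p * deriv (cutoff h n) p.1 * cutoff h n p.2 := by
    rintro n ⟨x, y⟩
    have e1 := hasDerivAt_fst (hT n).1 x y
    have e2 := (hasDerivAt_fst hg x y).mul
      ((((contDiff_cutoff h n).differentiable (by simp) x).hasDerivAt).mul_const (cutoff h n y))
    rw [e1.unique e2]; ring
  have hfin : IsFiniteMeasure (volume.restrict (Omega ε)) :=
    ⟨by simpa using volume_Omega_lt_top ε⟩
  have hd := continuous_fderiv_apply hg ex
  obtain ⟨D, hD⟩ := (isCompact_Icc.prod isCompact_Icc :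
    IsCompact (Set.Icc (-h) h ×ˢ Set.Icc (-h) h)).exists_bound_of_continuousOn hd.continuousOn
  obtain ⟨D', hD'⟩ := (isCompact_Icc.prod isCompact_Icc :
    IsCompact (Set.Icc (-h) h ×ˢ Set.Icc (-h) h)).exists_bound_of_continuousOn
      hg.continuous.continuousOn
  have hfi : Integrable f (volume.restrict (Omega ε)) := hf.integrable (by norm_num)
  have hfi' : Integrable f' (volume.restrict (Omega ε)) := hf'.integrable (by norm_num)
  have hone : ∀ p ∈ Omega ε, ∀ᶠ n : ℕ in Filter.atTop,
      cutoff h n p.1 = 1 ∧ cutoff h n p.2 = 1 ∧ deriv (cutoff h n) p.1 = 0 := by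
    intro p hp
    filter_upwards [eventually_cutoff_eq_one hp.1, eventually_cutoff_eq_one hp.2] with n h1 h2
    have h3 : cutoff h n =ᶠ[nhds p.1] fun _ => 1 := h1
    exact ⟨h1.self_of_nhds, h2.self_of_nhds, by rw [h3.deriv_eq, deriv_const]⟩
  have l1 : Filter.Tendsto (fun n : ℕ => ∫ p in Omega ε,
      f p * fderiv ℝ (fun p => g p * (cutoff h n p.1 * cutoff h n p.2)) p ex) Filter.atTop
      (nhds (∫ p in Omega ε, f p * fderiv ℝ g p ex)) := by
    refine tendsto_integral_of_dominated_convergence (fun p => |f p| * (D + C)) (fun n => ?_)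
      (hfi.abs.mul_const _) (fun n => ?_) ?_
    · exact hfi.aestronglyMeasurable.mul
        (continuous_fderiv_apply (hT n).1 ex).aestronglyMeasurable
    · filter_upwards [ae_restrict_mem (measurableSet_Omega ε)] with p hp
      rw [hfd, Real.norm_eq_abs, abs_mul]
      refine mul_le_mul_of_nonneg_left ((abs_add_le _ _).trans (add_le_add ?_ ?_)) (abs_nonneg _)
      · have b1 : |fderiv ℝ g p ex| ≤ D := hD p (Omega_subset ε hp)
        rw [abs_mul, abs_mul]
        have b2 := abs_cutoff_le_one h n p.1
        have b3 := abs_cutoff_le_one h n p.2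
        calc _ ≤ D * (1 * 1) := by gcongr; exact (abs_nonneg _).trans b1
          _ = D := by ring
      · rw [abs_mul]
        have b1 := hC n p.1 (g p) hp.1 (hgK p hp)
        calc _ ≤ C * 1 := by gcongr; exact abs_cutoff_le_one h n p.2
          _ = C := by ring
    · filter_upwards [ae_restrict_mem (measurableSet_Omega ε)] with p hp
      refine tendsto_const_nhds.congr' ?_
      filter_upwards [hone p hp] with n hn
      rw [hfd, hn.1, hn.2.1, hn.2.2]; ring
  have l2 : Filter.Tendsto (fun n : ℕ => ∫ p in Omega ε,
      f' p * (g p * (cutoff h n p.1 * cutoff h n p.2))) Filter.atTop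
      (nhds (∫ p in Omega ε, f' p * g p)) := by
    refine tendsto_integral_of_dominated_convergence (fun p => |f' p| * D') (fun n => ?_)
      (hfi'.abs.mul_const _) (fun n => ?_) ?_
    · exact hfi'.aestronglyMeasurable.mul (hT n).1.continuous.aestronglyMeasurable
    · filter_upwards [ae_restrict_mem (measurableSet_Omega ε)] with p hp
      rw [Real.norm_eq_abs, abs_mul]
      refine mul_le_mul_of_nonneg_left ?_ (abs_nonneg _)
      have b1 : |g p| ≤ D' := hD' p (Omega_subset ε hp)
      rw [abs_mul, abs_mul]
      have b2 := abs_cutoff_le_one h n p.1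
      have b3 := abs_cutoff_le_one h n p.2
      calc _ ≤ D' * (1 * 1) := by gcongr; exact (abs_nonneg _).trans b1
        _ = D' := by ring
    · filter_upwards [ae_restrict_mem (measurableSet_Omega ε)] with p hp
      refine tendsto_const_nhds.congr' ?_
      filter_upwards [hone p hp] with n hn
      rw [hn.1, hn.2.1]; ring
  exact tendsto_nhds_unique l1 (l2.neg.congr fun n => (hw _ (hT n)).symm)

/-! ### The weak Laplacian tested with a cosine mode -/

theorem contDiff_cos_mul_cos (a b : ℝ) :
    ContDiff ℝ ∞ fun p : ℝ × ℝ => Real.cos (a * p.1) * Real.cos (b * p.2) := by fun_prop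

theorem contDiff_sin_mul_cos (a b : ℝ) :
    ContDiff ℝ ∞ fun p : ℝ × ℝ => Real.sin (a * p.1) * Real.cos (b * p.2) := by fun_prop

theorem contDiff_cos_mul_sin (a b : ℝ) :
    ContDiff ℝ ∞ fun p : ℝ × ℝ => Real.cos (a * p.1) * Real.sin (b * p.2) := by fun_prop

/-- The function `sin(a·)` is `|a|`-Lipschitz and vanishes at `±h`; comparison with the nearer end
gives `|a|(h - |t|)`, and `h - |t| ≤ (h² - t²)/h`. -/
theorem abs_sin_mul_le {a h t : ℝ} (hh : 0 < h) (ha : Real.sin (a * h) = 0)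
    (ht : t ∈ Set.Ioo (-h) h) : |Real.sin (a * t)| ≤ |a| / h * (h ^ 2 - t ^ 2) := by
  have key : ∀ s, |Real.sin (a * t)| ≤ |a| * |t - s| ∨ Real.sin (a * s) ≠ 0 := by
    intro s
    by_cases hs : Real.sin (a * s) = 0
    · left
      have h1 : |Real.sin (a * t)| = |Real.sin (a * t) * Real.cos (a * s) -
          Real.cos (a * t) * Real.sin (a * s)| := by
        have : |Real.cos (a * s)| = 1 := by
          have := Real.sin_sq_add_cos_sq (a * s)
          rw [hs] at this
          rw [← sq_eq_sq₀ (abs_nonneg _) zero_le_one, sq_abs]; linarith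
        rw [hs, mul_zero, sub_zero, abs_mul, this, mul_one]
      rw [h1, ← Real.sin_sub, ← mul_sub, ← abs_mul]
      exact Real.abs_sin_le_abs
    · exact Or.inr hs
  have h1 : |a| / h * (h ^ 2 - t ^ 2) = |a| * ((h ^ 2 - t ^ 2) / h) := by ring
  rw [h1]
  rcases le_total 0 t with h0 | h0
  · refine ((key h).resolve_right (by simpa using ha)).trans ?_
    gcongr
    rw [abs_sub_comm, abs_of_nonneg (by linarith [ht.2]), le_div_iff₀ hh]
    nlinarith [ht.1, ht.2]
  · refine ((key (-h)).resolve_right (by simpa using ha)).trans ?_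
    gcongr
    rw [abs_of_nonneg (by linarith [ht.1]), le_div_iff₀ hh]
    nlinarith [ht.1, ht.2]

theorem cos_add_side {a ε : ℝ} (h : Real.sin (a * (side ε / 2)) = 0) (y : ℝ) :
    Real.cos (a * (y + side ε)) = Real.cos (a * y) := by
  have e : a * (y + side ε) = a * y + 2 * (a * (side ε / 2)) := by ring
  rw [e, Real.cos_add, Real.cos_two_mul', Real.sin_two_mul, h,
    show Real.cos (a * (side ε / 2)) ^ 2 = 1 by
      have := Real.sin_sq_add_cos_sq (a * (side ε / 2)); rw [h] at this; linarith]
  ring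

theorem sin_add_side {a ε : ℝ} (h : Real.sin (a * (side ε / 2)) = 0) (y : ℝ) :
    Real.sin (a * (y + side ε)) = Real.sin (a * y) := by
  have e : a * (y + side ε) = a * y + 2 * (a * (side ε / 2)) := by ring
  rw [e, Real.sin_add, Real.cos_two_mul', Real.sin_two_mul, h,
    show Real.cos (a * (side ε / 2)) ^ 2 = 1 by
      have := Real.sin_sq_add_cos_sq (a * (side ε / 2)); rw [h] at this; linarith]
  ring

/-- Two integrations by parts in each variable. In `x`, passing from `ζ_xx` to `ζ_x` uses the zero
slope of `ζ`, and passing from `ζ_x` to `ζ` uses that the sine vanishes at the ends. In `y`, both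
use periodicity. No approximation of `ζ` by smooth functions is involved. -/
theorem integral_lap_mul_cos_mul_cos {ε : ℝ} (hε : 0 < ε) {ζ : SobolevH2 (Omega ε)}
    (hz : ZeroSlopeAtEnds ζ) (hp : PeriodicInY ζ) {a b : ℝ}
    (ha : Real.sin (a * (side ε / 2)) = 0) (hb : Real.sin (b * (side ε / 2)) = 0) :
    ∫ p in Omega ε, ζ.lap p * (Real.cos (a * p.1) * Real.cos (b * p.2)) =
      -(a ^ 2 + b ^ 2) *
        ∫ p in Omega ε, ζ.val p * (Real.cos (a * p.1) * Real.cos (b * p.2)) := by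
  have h0 : 0 < side ε / 2 := by have := side_pos hε; positivity
  have d1 : ∀ p : ℝ × ℝ, fderiv ℝ (fun p : ℝ × ℝ => Real.cos (a * p.1) * Real.cos (b * p.2)) p ex =
      -a * (Real.sin (a * p.1) * Real.cos (b * p.2)) := fun p =>
    ((hasDerivAt_fst (contDiff_cos_mul_cos a b) p.1 p.2).unique
      ((hasDerivAt_cos_mul a p.1).mul_const (Real.cos (b * p.2)))).trans (by ring)
  have d2 : ∀ p : ℝ × ℝ, fderiv ℝ (fun p : ℝ × ℝ => Real.sin (a * p.1) * Real.cos (b * p.2)) p ex =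
      a * (Real.cos (a * p.1) * Real.cos (b * p.2)) := fun p =>
    ((hasDerivAt_fst (contDiff_sin_mul_cos a b) p.1 p.2).unique
      ((hasDerivAt_sin_mul a p.1).mul_const (Real.cos (b * p.2)))).trans (by ring)
  have d3 : ∀ p : ℝ × ℝ, fderiv ℝ (fun p : ℝ × ℝ => Real.cos (a * p.1) * Real.cos (b * p.2)) p ey =
      -b * (Real.cos (a * p.1) * Real.sin (b * p.2)) := fun p =>
    ((hasDerivAt_snd (contDiff_cos_mul_cos a b) p.1 p.2).unique
      ((hasDerivAt_cos_mul b p.2).const_mul (Real.cos (a * p.1)))).trans (by ring)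
  have d4 : ∀ p : ℝ × ℝ, fderiv ℝ (fun p : ℝ × ℝ => Real.cos (a * p.1) * Real.sin (b * p.2)) p ey =
      b * (Real.cos (a * p.1) * Real.cos (b * p.2)) := fun p =>
    ((hasDerivAt_snd (contDiff_cos_mul_sin a b) p.1 p.2).unique
      ((hasDerivAt_sin_mul b p.2).const_mul (Real.cos (a * p.1)))).trans (by ring)
  have e1 := hz _ (contDiff_cos_mul_cos a b)
  have e2 := HasWeakDeriv.intByParts_of_vanishing hε ζ.memLp_val ζ.memLp_dx ζ.weak_dx
    (contDiff_sin_mul_cos a b) (K := |a| / (side ε / 2)) (by positivity) fun p hp => by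
      rw [abs_mul]
      calc _ ≤ |Real.sin (a * p.1)| * 1 := by gcongr; exact Real.abs_cos_le_one _
        _ ≤ _ := by rw [mul_one]; exact abs_sin_mul_le h0 ha hp.1
  have e3 := hp.2 _ ⟨contDiff_cos_mul_cos a b, fun x y => by simp only [cos_add_side hb]⟩
  have e4 := hp.1 _ ⟨contDiff_cos_mul_sin a b, fun x y => by simp only [sin_add_side hb]⟩
  simp only [d1, d2, d3, d4] at e1 e2 e3 e4
  simp only [mul_left_comm _ (-a), mul_left_comm _ a, mul_left_comm _ (-b), mul_left_comm _ b,
    integral_const_mul] at e1 e2 e3 e4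
  simp only [SobolevH2.lap, add_mul]
  rw [integral_add (integrable_mul ζ.memLp_dxx (contDiff_cos_mul_cos a b).continuous)
    (integrable_mul ζ.memLp_dyy (contDiff_cos_mul_cos a b).continuous)]
  linear_combination e1 + a * e2 + e3 + b * e4

/-- Each mode is an eigenfunction of the bilaplacian with eigenvalue `(a² + b²)²`, so the weak
equation splits into scalar ones. They are stated without division, which admits the constant mode
as long as its right-hand side is zero. -/
theorem isAiryStress_cosSum {ι : Type*} {ε : ℝ} (hε : 0 < ε) {w : SobolevH2 (Omega ε)}
    (s : Finset ι) (c r a b : ι → ℝ) (ha : ∀ i, Real.sin (a i * (side ε / 2)) = 0)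
    (hb : ∀ i, Real.sin (b i * (side ε / 2)) = 0)
    (hr : ∀ i ∈ s, r i = -(a i ^ 2 + b i ^ 2) ^ 2 * c i)
    (hw : ∀ p, bracket w w p + w.dxx p =
      ∑ i ∈ s, r i * (Real.cos (a i * p.1) * Real.cos (b i * p.2))) :
    IsAiryStress w (cosSum hε s c a b) := by
  refine ⟨zeroSlopeAtEnds_cosSum hε s c a b ha, periodicInY_cosSum hε s c a b hb,
    fun ζ hz hp => ?_⟩
  have h1 : ∀ i, Continuous fun p : ℝ × ℝ => Real.cos (a i * p.1) * Real.cos (b i * p.2) :=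
    fun i => by fun_prop
  have e1 : ∀ p, (cosSum hε s c a b).lap p * ζ.lap p = ∑ i ∈ s, -(a i ^ 2 + b i ^ 2) * c i *
      (ζ.lap p * (Real.cos (a i * p.1) * Real.cos (b i * p.2))) := fun p => by
    rw [lap_cosSum, Finset.sum_mul]
    exact Finset.sum_congr rfl fun i _ => by ring
  have e2 : ∀ p, (bracket w w p + w.dxx p) * ζ.val p = ∑ i ∈ s, r i *
      (ζ.val p * (Real.cos (a i * p.1) * Real.cos (b i * p.2))) := fun p => by
    rw [hw, Finset.sum_mul]
    exact Finset.sum_congr rfl fun i _ => by ring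
  simp only [e1, e2]
  rw [integral_finsetSum _ fun i _ => (integrable_mul (memLp_lap ζ) (h1 i)).const_mul _,
    integral_finsetSum _ fun i _ => (integrable_mul ζ.memLp_val (h1 i)).const_mul _,
    ← Finset.sum_neg_distrib]
  refine Finset.sum_congr rfl fun i hi => ?_
  rw [integral_const_mul, integral_const_mul,
    integral_lap_mul_cos_mul_cos hε hz hp (ha i) (hb i), hr i hi]
  ring

/-! ### Fourier modes on the rectangle -/

theorem integral_cos_mul_cos {ε : ℝ} (hε : 0 < ε) {μ : ℝ} (hμ : μ ≠ 0)
    (hs : ∀ n : ℤ, Real.sin (n * μ * (side ε / 2)) = 0) (p q : ℤ) :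
    ∫ z in Omega ε, Real.cos (p * μ * z.1) * Real.cos (q * μ * z.2) =
      if p = 0 ∧ q = 0 then side ε ^ 2 else 0 := by
  have h1 : ∀ n : ℤ, ∫ t in Set.Ioo (-(side ε / 2)) (side ε / 2), Real.cos (n * μ * t) =
      if n = 0 then side ε else 0 := by
    intro n
    have := side_pos hε
    rw [← integral_Ioc_eq_integral_Ioo, ← intervalIntegral.integral_of_le (by linarith)]
    split_ifs with h
    · simp [h]
    · have hn : (n : ℝ) * μ ≠ 0 := mul_ne_zero (by exact_mod_cast h) hμ
      rw [intervalIntegral.integral_eq_sub_of_hasDerivAt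
        (f := fun t => (n * μ : ℝ)⁻¹ * Real.sin (n * μ * t)) (fun x _ =>
          ((hasDerivAt_sin_mul (n * μ) x).const_mul _).congr_deriv (by field_simp))
        (Continuous.intervalIntegrable (by fun_prop) _ _)]
      simp [hs]
  rw [Omega, Measure.volume_eq_prod, setIntegral_prod_mul
    (fun x => Real.cos (p * μ * x)) (fun y => Real.cos (q * μ * y)), h1, h1]
  by_cases hp : p = 0 <;> by_cases hq : q = 0 <;> simp [hp, hq, sq]

theorem integral_sin_mul_sin {ε : ℝ} (hε : 0 < ε) (a b : ℝ) :
    ∫ z in Omega ε, Real.sin (a * z.1) * Real.sin (b * z.2) = 0 := by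
  have := side_pos hε
  rw [Omega, Measure.volume_eq_prod, setIntegral_prod_mul
    (fun x => Real.sin (a * x)) (fun y => Real.sin (b * y)), ← integral_Ioc_eq_integral_Ioo,
    ← intervalIntegral.integral_of_le (by linarith)]
  have e := intervalIntegral.integral_comp_neg (a := -(side ε / 2)) (b := side ε / 2)
    fun t => Real.sin (a * t)
  simp only [mul_neg, Real.sin_neg, neg_neg, intervalIntegral.integral_neg] at e
  rw [show ∫ t in (-(side ε / 2))..(side ε / 2), Real.sin (a * t) = 0 by linarith, zero_mul]

theorem integral_cos_add {ε : ℝ} (hε : 0 < ε) {μ : ℝ} (hμ : μ ≠ 0)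
    (hs : ∀ n : ℤ, Real.sin (n * μ * (side ε / 2)) = 0) (p q : ℤ) :
    ∫ z in Omega ε, Real.cos (p * μ * z.1 + q * μ * z.2) =
      if p = 0 ∧ q = 0 then side ε ^ 2 else 0 := by
  simp only [Real.cos_add]
  rw [integral_sub (Continuous.integrableOn_Omega (by fun_prop))
    (Continuous.integrableOn_Omega (by fun_prop)), integral_cos_mul_cos hε hμ hs,
    integral_sin_mul_sin hε, sub_zero]

/-- Bessel's inequality for sums of plane waves. -/
theorem integral_sum_cos_add_sq_le {ι : Type*} {ε : ℝ} (hε : 0 < ε) {μ : ℝ} (hμ : μ ≠ 0)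
    (hs : ∀ n : ℤ, Real.sin (n * μ * (side ε / 2)) = 0) (s : Finset ι) (c : ι → ℝ) (p q : ι → ℤ)
    (hinj : ∀ i ∈ s, ∀ j ∈ s, p i = p j → q i = q j → i = j) :
    ∫ z in Omega ε, (∑ i ∈ s, c i * Real.cos (p i * μ * z.1 + q i * μ * z.2)) ^ 2 ≤
      side ε ^ 2 * ∑ i ∈ s, c i ^ 2 := by
  -- The sine sum completes the square to `|∑ c e^{i(…)}|²`. Exponentials with distinct wave vectors
  -- are orthogonal, whereas cosines with opposite wave vectors coincide, and the sums below run
  -- over both signs.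
  have h1 : ∫ z in Omega ε, ((∑ i ∈ s, c i * Real.cos (p i * μ * z.1 + q i * μ * z.2)) ^ 2 +
      (∑ i ∈ s, c i * Real.sin (p i * μ * z.1 + q i * μ * z.2)) ^ 2) =
      side ε ^ 2 * ∑ i ∈ s, c i ^ 2 := by
    have e : ∀ z : ℝ × ℝ, (∑ i ∈ s, c i * Real.cos (p i * μ * z.1 + q i * μ * z.2)) ^ 2 +
        (∑ i ∈ s, c i * Real.sin (p i * μ * z.1 + q i * μ * z.2)) ^ 2 =
        ∑ i ∈ s, ∑ j ∈ s, c i * c j *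
          Real.cos ((p i - p j : ℤ) * μ * z.1 + (q i - q j : ℤ) * μ * z.2) := by
      intro z
      rw [sq, sq, Finset.sum_mul_sum, Finset.sum_mul_sum, ← Finset.sum_add_distrib]
      refine Finset.sum_congr rfl fun i _ => ?_
      rw [← Finset.sum_add_distrib]
      refine Finset.sum_congr rfl fun j _ => ?_
      rw [show ((p i - p j : ℤ) : ℝ) * μ * z.1 + ((q i - q j : ℤ) : ℝ) * μ * z.2 =
        (p i * μ * z.1 + q i * μ * z.2) - (p j * μ * z.1 + q j * μ * z.2) by push_cast; ring,
        Real.cos_sub]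
      ring
    simp only [e]
    rw [integral_finsetSum _ fun i _ => Continuous.integrableOn_Omega (by fun_prop),
      Finset.mul_sum]
    refine Finset.sum_congr rfl fun i hi => ?_
    rw [integral_finsetSum _ fun i _ => Continuous.integrableOn_Omega (by fun_prop),
      Finset.sum_eq_single_of_mem i hi]
    · rw [integral_const_mul, integral_cos_add hε hμ hs]; simp; ring
    · intro j hj hij
      rw [integral_const_mul, integral_cos_add hε hμ hs, if_neg, mul_zero]
      exact fun h => hij (hinj i hi j hj (by linarith [h.1]) (by linarith [h.2])).symm
  rw [← h1]
  exact setIntegral_mono (Continuous.integrableOn_Omega (by fun_prop))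
    (Continuous.integrableOn_Omega (by fun_prop)) fun z => le_add_of_nonneg_right (sq_nonneg _)

/-- Bessel's inequality for sums of products of cosines. -/
theorem integral_sum_cos_mul_cos_sq_le {ι : Type*} {ε : ℝ} (hε : 0 < ε) {μ : ℝ} (hμ : μ ≠ 0)
    (hs : ∀ n : ℤ, Real.sin (n * μ * (side ε / 2)) = 0) (s : Finset ι) (c : ι → ℝ) (p q : ι → ℤ)
    (hinj : ∀ i ∈ s, ∀ j ∈ s, p i = p j → q i = q j → i = j) :
    ∫ z in Omega ε, (∑ i ∈ s, c i * (Real.cos (p i * μ * z.1) * Real.cos (q i * μ * z.2))) ^ 2 ≤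
      side ε ^ 2 * ∑ i ∈ s, c i ^ 2 := by
  have h1 := integral_sum_cos_add_sq_le hε hμ hs s c p q hinj
  have h2 := integral_sum_cos_add_sq_le hε hμ hs s c p (fun i => -q i)
    fun i hi j hj h h' => hinj i hi j hj h (neg_inj.1 h')
  -- A product of cosines is the mean of the plane waves with wave vectors `(p, q)` and `(p, -q)`;
  -- the square is convex.
  have h3 : ∫ z in Omega ε,
      (∑ i ∈ s, c i * (Real.cos (p i * μ * z.1) * Real.cos (q i * μ * z.2))) ^ 2 ≤
      ∫ z in Omega ε, (1 / 2 * (∑ i ∈ s, c i * Real.cos (p i * μ * z.1 + q i * μ * z.2)) ^ 2 +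
        1 / 2 * (∑ i ∈ s, c i * Real.cos (p i * μ * z.1 + (-q i : ℤ) * μ * z.2)) ^ 2) := by
    refine setIntegral_mono (Continuous.integrableOn_Omega (by fun_prop))
      (Continuous.integrableOn_Omega (by fun_prop)) fun z => ?_
    have e : ∑ i ∈ s, c i * (Real.cos (p i * μ * z.1) * Real.cos (q i * μ * z.2)) =
        1 / 2 * (∑ i ∈ s, c i * Real.cos (p i * μ * z.1 + q i * μ * z.2) +
          ∑ i ∈ s, c i * Real.cos (p i * μ * z.1 + (-q i : ℤ) * μ * z.2)) := by
      rw [← Finset.sum_add_distrib, Finset.mul_sum]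
      refine Finset.sum_congr rfl fun i _ => ?_
      push_cast
      rw [neg_mul, neg_mul, ← sub_eq_add_neg, Real.cos_add, Real.cos_sub]
      ring
    simp only [e]
    nlinarith [sq_nonneg (∑ i ∈ s, c i * Real.cos (p i * μ * z.1 + q i * μ * z.2) -
      ∑ i ∈ s, c i * Real.cos (p i * μ * z.1 + (-q i : ℤ) * μ * z.2))]
  rw [integral_add (Continuous.integrableOn_Omega (by fun_prop))
    (Continuous.integrableOn_Omega (by fun_prop)), integral_const_mul, integral_const_mul] at h3
  linarith

/-! ### The Fourier coefficients of the ridges -/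

/-- The Fourier coefficients `(1 - n²/N²)₊` of an approximate Dirac mass. -/
noncomputable def ridge (N : ℕ) (n : ℤ) : ℝ := max 0 (1 - (n : ℝ) ^ 2 / (N : ℝ) ^ 2)

theorem ridge_nonneg (N : ℕ) (n : ℤ) : 0 ≤ ridge N n := le_max_left _ _

theorem ridge_le_one (N : ℕ) (n : ℤ) : ridge N n ≤ 1 :=
  max_le zero_le_one (by have : (0 : ℝ) ≤ (n : ℝ) ^ 2 / (N : ℝ) ^ 2 := by positivity
                         linarith)

theorem ridge_zero (N : ℕ) : ridge N 0 = 1 := by simp [ridge]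

theorem ridge_neg (N : ℕ) (n : ℤ) : ridge N (-n) = ridge N n := by simp [ridge]

theorem one_sub_ridge_le (N : ℕ) (n : ℤ) : 1 - ridge N n ≤ (n : ℝ) ^ 2 / (N : ℝ) ^ 2 := by
  have := le_max_right 0 (1 - (n : ℝ) ^ 2 / (N : ℝ) ^ 2)
  simp only [ridge]; linarith

theorem ridge_eq_zero {N : ℕ} (hN : 0 < N) {n : ℤ} (hn : (N : ℤ) ≤ |n|) : ridge N n = 0 := by
  have h1 : (N : ℝ) ≤ |(n : ℝ)| := by exact_mod_cast hn
  refine max_eq_left ?_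
  rw [sub_nonpos, le_div_iff₀ (by positivity), one_mul, ← sq_abs (n : ℝ)]
  gcongr

theorem ridge_one_ge {N : ℕ} (hN : 2 ≤ N) : 3 / 4 ≤ ridge N 1 := by
  refine le_trans ?_ (le_max_right _ _)
  have h1 : (2 : ℝ) ≤ N := by exact_mod_cast hN
  have : ((1 : ℤ) : ℝ) ^ 2 / (N : ℝ) ^ 2 ≤ 1 / 4 := by
    rw [div_le_div_iff₀ (by positivity) (by norm_num)]; push_cast; nlinarith
  linarith

/-- The sum `n + m` appears because the coefficients are even: with `u = min(1, |n|/N)` and `v =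
min(1, |m|/N)` the difference is `(v - u)(u + v)`, where `u + v ≤ 2` and `||n| - |m|| ≤ |n + m|`. -/
theorem ridge_sub_sq_le {N : ℕ} (hN : 0 < N) (n m : ℤ) :
    (ridge N n - ridge N m) ^ 2 ≤ 4 * ((n + m : ℤ) : ℝ) ^ 2 / (N : ℝ) ^ 2 := by
  have hN' : (0 : ℝ) < N := by exact_mod_cast hN
  have key : ∀ t : ℝ, 0 ≤ t → max 0 (1 - t ^ 2) = 1 - (min 1 t) ^ 2 := by
    intro t ht
    rcases le_total 1 t with h | h
    · rw [min_eq_left h, max_eq_left (by nlinarith)]; norm_num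
    · rw [min_eq_right h, max_eq_right (by nlinarith)]
  have e : ∀ k : ℤ, ridge N k = 1 - (min 1 (|(k : ℝ)| / N)) ^ 2 := fun k => by
    rw [← key _ (by positivity), ridge, div_pow, sq_abs]
  have h1 : |min 1 (|(n : ℝ)| / N) - min 1 (|(m : ℝ)| / N)| ≤ |((n + m : ℤ) : ℝ)| / N := by
    refine (abs_min_sub_min_le_max 1 _ 1 _).trans ?_
    rw [sub_self, abs_zero, max_eq_right (abs_nonneg _), ← sub_div, abs_div, abs_of_pos hN']
    have := abs_abs_sub_abs_le (n : ℝ) (-m)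
    rw [abs_neg, sub_neg_eq_add] at this
    exact div_le_div_of_nonneg_right (by push_cast; exact this) hN'.le
  rw [e, e]
  set u := min 1 (|(n : ℝ)| / N)
  set v := min 1 (|(m : ℝ)| / N)
  have hu : u ≤ 1 := min_le_left _ _
  have hv : v ≤ 1 := min_le_left _ _
  have hu0 : 0 ≤ u := le_min zero_le_one (by positivity)
  have hv0 : 0 ≤ v := le_min zero_le_one (by positivity)
  have h2 : (u - v) ^ 2 ≤ ((n + m : ℤ) : ℝ) ^ 2 / (N : ℝ) ^ 2 := by
    rw [← sq_abs (u - v), ← sq_abs (((n + m : ℤ) : ℝ)), ← div_pow]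
    gcongr
  have h3 : (u + v) ^ 2 ≤ 4 := by nlinarith
  calc (1 - u ^ 2 - (1 - v ^ 2)) ^ 2 = (u + v) ^ 2 * (u - v) ^ 2 := by ring
    _ ≤ 4 * (((n + m : ℤ) : ℝ) ^ 2 / (N : ℝ) ^ 2) := by gcongr
    _ = _ := by ring

/-- The Fourier coefficients of `[w, w] + w_xx`. -/
noncomputable def defect (N : ℕ) (n m : ℤ) : ℝ :=
  ridge N n * ridge N m - 1 / 2 * (ridge N (n + m) * (ridge N n ^ 2 + ridge N m ^ 2))

theorem defect_comm (N : ℕ) (n m : ℤ) : defect N m n = defect N n m := by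
  rw [defect, defect, add_comm m n]; ring

/-- The coefficients of the defect are small of second order in the wave number `n + m` in `y`. -/
theorem abs_defect_le {N : ℕ} (hN : 0 < N) (n m : ℤ) :
    |defect N n m| ≤ 3 * ((n + m : ℤ) : ℝ) ^ 2 / (N : ℝ) ^ 2 := by
  -- Both terms vanish for `m = -n`, to second order in `n + m`: the first by evenness and the
  -- Lipschitz bound, the second because the coefficients are quadratically flat at `0`.
  have e : defect N n m = -(1 / 2) * (ridge N n - ridge N m) ^ 2 +
      1 / 2 * ((1 - ridge N (n + m)) * (ridge N n ^ 2 + ridge N m ^ 2)) := by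
    rw [defect]; ring
  have h1 := ridge_sub_sq_le hN n m
  have h2 := one_sub_ridge_le N (n + m)
  have h3 := ridge_le_one N (n + m)
  have h4 : ridge N n ^ 2 ≤ 1 := pow_le_one₀ (ridge_nonneg N n) (ridge_le_one N n)
  have h5 : ridge N m ^ 2 ≤ 1 := pow_le_one₀ (ridge_nonneg N m) (ridge_le_one N m)
  have h6 : (1 - ridge N (n + m)) * (ridge N n ^ 2 + ridge N m ^ 2) ≤
      ((n + m : ℤ) : ℝ) ^ 2 / (N : ℝ) ^ 2 * 2 := by gcongr; linarith
  have h7 : 0 ≤ (1 - ridge N (n + m)) * (ridge N n ^ 2 + ridge N m ^ 2) :=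
    mul_nonneg (by linarith) (by positivity)
  have h8 : 0 ≤ ((n + m : ℤ) : ℝ) ^ 2 / (N : ℝ) ^ 2 := by positivity
  rw [mul_div_assoc] at h1 ⊢
  rw [e, abs_le]
  constructor <;> nlinarith [sq_nonneg (ridge N n - ridge N m)]

/-! ### The quadratic identity for the Fourier sums -/

theorem sum_Icc_neg (K : ℤ) (g : ℤ → ℝ) :
    ∑ n ∈ Finset.Icc (-K) K, g (-n) = ∑ n ∈ Finset.Icc (-K) K, g n :=
  Finset.sum_nbij' (fun n => -n) (fun n => -n)
    (fun n hn => by rw [Finset.mem_Icc] at *; omega)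
    (fun n hn => by rw [Finset.mem_Icc] at *; omega) (by simp) (by simp) (by simp)

theorem sum_even_mul_sin (K : ℤ) {f : ℤ → ℝ} (hf : ∀ n, f (-n) = f n) (t : ℝ) :
    ∑ n ∈ Finset.Icc (-K) K, f n * Real.sin (n * t) = 0 := by
  have h := sum_Icc_neg K fun n => f n * Real.sin (n * t)
  simp only [hf, Int.cast_neg, neg_mul, Real.sin_neg, mul_neg, Finset.sum_neg_distrib] at h
  linarith

theorem sum_even_mul_cos_add (K : ℤ) {f : ℤ → ℝ} (hf : ∀ n, f (-n) = f n) (t u : ℝ) :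
    ∑ n ∈ Finset.Icc (-K) K, f n * Real.cos (n * t + u) =
      (∑ n ∈ Finset.Icc (-K) K, f n * Real.cos (n * t)) * Real.cos u := by
  have h : ∀ n : ℤ, f n * Real.cos (n * t + u) =
      f n * Real.cos (n * t) * Real.cos u - f n * Real.sin (n * t) * Real.sin u := fun n => by
    rw [Real.cos_add]; ring
  simp only [h]
  rw [Finset.sum_sub_distrib, ← Finset.sum_mul, ← Finset.sum_mul, sum_even_mul_sin K hf]
  ring

/-- The coefficients live on `|m| < N`, so the range `[-2N, 2N]` contains every translate by at most
`N` of the support. Both sides are therefore sums over all of `ℤ`. -/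
theorem sum_shift_ridge {N : ℕ} (hN : 0 < N) {n : ℤ} (hn : |n| ≤ N) (g : ℤ → ℝ) :
    ∑ m ∈ Finset.Icc (-(2 * N : ℤ)) (2 * N), ridge N (n + m) * g (n + m) =
      ∑ m ∈ Finset.Icc (-(2 * N : ℤ)) (2 * N), ridge N m * g m := by
  have h0 : ∀ m : ℤ, (N : ℤ) ≤ |m| → ridge N m * g m = 0 := fun m hm => by
    rw [ridge_eq_zero hN hm, zero_mul]
  rw [abs_le] at hn
  rw [← tsum_eq_sum (L := .unconditional ℤ) (f := fun m => ridge N (n + m) * g (n + m)) fun m hm => by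
      apply h0
      rw [Finset.mem_Icc, not_and_or] at hm
      rw [le_abs]; omega,
    ← tsum_eq_sum (L := .unconditional ℤ) (f := fun m => ridge N m * g m) fun m hm => by
      apply h0
      rw [Finset.mem_Icc, not_and_or] at hm
      rw [le_abs]; omega]
  exact (Equiv.addLeft n).tsum_eq fun m => ridge N m * g m

/-- Substitution of `p = n + m` turns the phase into `pη + n(ξ - η)`, and the double sum factors by
parity. -/
theorem sum_ridge_sq_mul_ridge_add {N : ℕ} (hN : 0 < N) (ξ η : ℝ) :
    ∑ n ∈ Finset.Icc (-(2 * N : ℤ)) (2 * N), ∑ m ∈ Finset.Icc (-(2 * N : ℤ)) (2 * N),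
        ridge N (n + m) * ridge N n ^ 2 * Real.cos (n * ξ + m * η) =
      (∑ n ∈ Finset.Icc (-(2 * N : ℤ)) (2 * N), ridge N n ^ 2 * Real.cos (n * (η - ξ))) *
        ∑ n ∈ Finset.Icc (-(2 * N : ℤ)) (2 * N), ridge N n * Real.cos (n * η) := by
  rw [Finset.sum_mul]
  have h1 : ∀ n ∈ Finset.Icc (-(2 * N : ℤ)) (2 * N),
      ∑ m ∈ Finset.Icc (-(2 * N : ℤ)) (2 * N),
        ridge N (n + m) * ridge N n ^ 2 * Real.cos (n * ξ + m * η) =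
      ridge N n ^ 2 * Real.cos (n * (η - ξ)) *
        ∑ n ∈ Finset.Icc (-(2 * N : ℤ)) (2 * N), ridge N n * Real.cos (n * η) := by
    intro n _
    by_cases hn : (N : ℤ) ≤ |n|
    · simp [ridge_eq_zero hN hn]
    · have h2 := sum_shift_ridge hN (not_le.1 hn).le fun p => Real.cos (p * η + n * (ξ - η))
      rw [sum_even_mul_cos_add _ (ridge_neg N)] at h2
      have h3 : Real.cos (n * (ξ - η)) = Real.cos (n * (η - ξ)) := by
        rw [← Real.cos_neg]; congr 1; ring
      rw [h3] at h2
      rw [mul_assoc (ridge N n ^ 2), mul_comm (Real.cos _), ← h2, Finset.mul_sum]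
      refine Finset.sum_congr rfl fun m _ => ?_
      push_cast
      rw [show ((n : ℝ) + m) * η + n * (ξ - η) = n * ξ + m * η by ring]
      ring
  exact Finset.sum_congr rfl h1

/-- The smoothed form of `δ(ξ)δ(η) = δ(η - ξ) · ½(δ(ξ) + δ(η))`. Squared coefficients in the mass at
`η - ξ` make the error vanish at `n + m = 0`. -/
theorem sum_defect {N : ℕ} (hN : 0 < N) (ξ η : ℝ) :
    ∑ n ∈ Finset.Icc (-(2 * N : ℤ)) (2 * N), ∑ m ∈ Finset.Icc (-(2 * N : ℤ)) (2 * N),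
        defect N n m * Real.cos (n * ξ + m * η) =
      (∑ n ∈ Finset.Icc (-(2 * N : ℤ)) (2 * N), ridge N n * Real.cos (n * ξ)) *
          (∑ n ∈ Finset.Icc (-(2 * N : ℤ)) (2 * N), ridge N n * Real.cos (n * η)) -
        (∑ n ∈ Finset.Icc (-(2 * N : ℤ)) (2 * N), ridge N n ^ 2 * Real.cos (n * (η - ξ))) *
          (1 / 2 * ((∑ n ∈ Finset.Icc (-(2 * N : ℤ)) (2 * N), ridge N n * Real.cos (n * ξ)) +
            ∑ n ∈ Finset.Icc (-(2 * N : ℤ)) (2 * N), ridge N n * Real.cos (n * η))) := by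
  have h1 := sum_ridge_sq_mul_ridge_add hN ξ η
  have h2 := sum_ridge_sq_mul_ridge_add hN η ξ
  rw [Finset.sum_comm] at h2
  have h3 : ∀ n : ℤ, Real.cos (n * (ξ - η)) = Real.cos (n * (η - ξ)) := fun n => by
    rw [← Real.cos_neg]; congr 1; ring
  simp only [h3] at h2
  have h4 : ∑ n ∈ Finset.Icc (-(2 * N : ℤ)) (2 * N), ∑ m ∈ Finset.Icc (-(2 * N : ℤ)) (2 * N),
        ridge N n * (ridge N m * Real.cos (m * η + n * ξ)) =
      (∑ n ∈ Finset.Icc (-(2 * N : ℤ)) (2 * N), ridge N n * Real.cos (n * ξ)) *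
          (∑ n ∈ Finset.Icc (-(2 * N : ℤ)) (2 * N), ridge N n * Real.cos (n * η)) := by
    rw [Finset.sum_mul]
    refine Finset.sum_congr rfl fun n _ => ?_
    rw [← Finset.mul_sum, sum_even_mul_cos_add _ (ridge_neg N)]
    ring
  rw [← h4, mul_left_comm, mul_add, ← h1, ← h2, ← Finset.sum_add_distrib, Finset.mul_sum,
    ← Finset.sum_sub_distrib]
  refine Finset.sum_congr rfl fun n _ => ?_
  rw [← Finset.sum_add_distrib, Finset.mul_sum, ← Finset.sum_sub_distrib]
  refine Finset.sum_congr rfl fun m _ => ?_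
  rw [defect, add_comm (m * η), add_comm m n]
  ring

/-- In the addition formula the product of sines is antisymmetric under exchange of `n` and `m`,
while the defect is symmetric, so that part cancels. -/
theorem sum_defect_cos_mul_cos (N : ℕ) (X Y : ℝ) :
    ∑ i ∈ Finset.Icc (-(2 * N : ℤ)) (2 * N) ×ˢ Finset.Icc (-(2 * N : ℤ)) (2 * N),
        defect N i.1 i.2 * (Real.cos ((i.2 - i.1 : ℤ) * X) * Real.cos ((i.1 + i.2 : ℤ) * Y)) =
      ∑ n ∈ Finset.Icc (-(2 * N : ℤ)) (2 * N), ∑ m ∈ Finset.Icc (-(2 * N : ℤ)) (2 * N),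
        defect N n m * Real.cos (n * (Y - X) + m * (X + Y)) := by
  rw [Finset.sum_product]
  have h1 : ∑ n ∈ Finset.Icc (-(2 * N : ℤ)) (2 * N), ∑ m ∈ Finset.Icc (-(2 * N : ℤ)) (2 * N),
      defect N n m * (Real.sin ((m - n : ℤ) * X) * Real.sin ((n + m : ℤ) * Y)) = 0 := by
    have h := Finset.sum_comm (s := Finset.Icc (-(2 * N : ℤ)) (2 * N))
      (t := Finset.Icc (-(2 * N : ℤ)) (2 * N))
      (f := fun n m => defect N n m * (Real.sin ((m - n : ℤ) * X) * Real.sin ((n + m : ℤ) * Y)))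
    have h2 : ∀ n m : ℤ, defect N n m *
        (Real.sin ((m - n : ℤ) * X) * Real.sin ((n + m : ℤ) * Y)) =
        -(defect N m n * (Real.sin ((n - m : ℤ) * X) * Real.sin ((m + n : ℤ) * Y))) := fun n m => by
      rw [defect_comm, add_comm m n, show ((m - n : ℤ) : ℝ) * X = -(((n - m : ℤ) : ℝ) * X) by
        push_cast; ring, Real.sin_neg]
      ring
    conv_rhs at h =>
      enter [2, m, 2, n]
      rw [h2]
    simp only [Finset.sum_neg_distrib] at h
    linarith
  rw [← sub_zero (∑ n ∈ Finset.Icc (-(2 * N : ℤ)) (2 * N), _), ← h1, ← Finset.sum_sub_distrib]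
  refine Finset.sum_congr rfl fun n _ => ?_
  rw [← Finset.sum_sub_distrib]
  refine Finset.sum_congr rfl fun m _ => ?_
  rw [show n * (Y - X) + m * (X + Y) = ((m - n : ℤ) : ℝ) * X + ((n + m : ℤ) : ℝ) * Y by
    push_cast; ring, Real.cos_add]
  ring

/-! ### The Yoshimura pattern -/

section Pattern

variable {ε : ℝ} (hε : 0 < ε) (N : ℕ) (μ : ℝ)

/-- The range of wave numbers. -/
noncomputable def waves (N : ℕ) : Finset ℤ := Finset.Icc (-(2 * N : ℤ)) (2 * N)

/-- The amplitudes of the pattern. The mode `n = 0` is absent, since `x / 0 = 0`. -/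
noncomputable def amplitude (N : ℕ) (μ : ℝ) : ℤ ⊕ ℤ → ℝ :=
  Sum.elim (fun n => -(ridge N n / (n ^ 2 * μ ^ 2)))
    (fun n => ridge N n ^ 2 / (4 * n ^ 2 * μ ^ 2))

/-- The wave numbers of the pattern in `x`. -/
def waveX : ℤ ⊕ ℤ → ℤ := Sum.elim (fun n => n) (fun n => 2 * n)

/-- The wave numbers of the pattern in `y`. -/
def waveY : ℤ ⊕ ℤ → ℤ := Sum.elim (fun n => n) (fun _ => 0)

/-- A diamond pattern of nearly flat facets, with ridges of relative width `1 / N`. -/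
noncomputable def pattern : SobolevH2 (Omega ε) :=
  cosSum hε ((waves N).disjSum (waves N)) (amplitude N μ) (fun i => waveX i * μ)
    (fun i => waveY i * μ)

/-- The sum of the oblique ridges. -/
noncomputable def obliqueSum (N : ℕ) (X Y : ℝ) : ℝ :=
  ∑ n ∈ waves N, ridge N n * (Real.cos (n * X) * Real.cos (n * Y))

/-- The sum of the ridges parallel to the `y`-axis. -/
noncomputable def hoopSum (N : ℕ) (X : ℝ) : ℝ :=
  ∑ n ∈ waves N, ridge N n ^ 2 * Real.cos (n * (2 * X))

theorem zero_mem_waves (N : ℕ) : (0 : ℤ) ∈ waves N := by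
  rw [waves, Finset.mem_Icc]; omega

variable {N μ}

theorem pattern_dxx (hμ : μ ≠ 0) (p : ℝ × ℝ) :
    (pattern hε N μ).dxx p = obliqueSum N (μ * p.1) (μ * p.2) - hoopSum N (μ * p.1) := by
  simp only [pattern, cosSum, Finset.sum_disjSum, amplitude, waveX, waveY, Sum.elim_inl,
    Sum.elim_inr, obliqueSum, hoopSum]
  rw [← Finset.sum_add_distrib, ← Finset.sum_sub_distrib]
  refine Finset.sum_congr rfl fun n _ => ?_
  by_cases hn : n = 0
  -- The amplitude is zero here, and the constant terms of the two ridge sums, both equal to 1,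
  -- cancel.
  · simp [hn, ridge_zero]
  · have hn' : (n : ℝ) ≠ 0 := by exact_mod_cast hn
    push_cast
    rw [zero_mul, zero_mul, Real.cos_zero, mul_assoc (n : ℝ) μ, mul_assoc (n : ℝ) μ,
      show 2 * (n : ℝ) * μ * p.1 = n * (2 * (μ * p.1)) by ring]
    field_simp
    ring

theorem pattern_dyy (hμ : μ ≠ 0) (p : ℝ × ℝ) :
    (pattern hε N μ).dyy p = obliqueSum N (μ * p.1) (μ * p.2) - 1 := by
  simp only [pattern, cosSum, Finset.sum_disjSum, amplitude, waveX, waveY, Sum.elim_inl,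
    Sum.elim_inr, obliqueSum]
  -- The constant term of `obliqueSum` is split off; it is the 1 that is subtracted.
  rw [← Finset.sum_add_distrib, ← Finset.add_sum_erase _ _ (zero_mem_waves N),
    ← Finset.add_sum_erase _ (fun n : ℤ => ridge N n * _) (zero_mem_waves N)]
  simp only [Int.cast_zero, zero_mul, Real.cos_zero, ridge_zero, mul_one, mul_zero, neg_zero,
    add_zero, zero_add, add_sub_cancel_left]
  refine Finset.sum_congr rfl fun n hn => ?_
  have hn' : (n : ℝ) ≠ 0 := by exact_mod_cast Finset.ne_of_mem_erase hn
  rw [mul_assoc (n : ℝ) μ, mul_assoc (n : ℝ) μ]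
  field_simp

theorem pattern_dxy (hμ : μ ≠ 0) (p : ℝ × ℝ) :
    (pattern hε N μ).dxy p =
      -∑ n ∈ waves N, ridge N n * (Real.sin (n * (μ * p.1)) * Real.sin (n * (μ * p.2))) := by
  simp only [pattern, cosSum, Finset.sum_disjSum, amplitude, waveX, waveY, Sum.elim_inl,
    Sum.elim_inr]
  rw [← Finset.sum_add_distrib, ← Finset.sum_neg_distrib]
  refine Finset.sum_congr rfl fun n _ => ?_
  by_cases hn : n = 0
  · simp [hn]
  · have hn' : (n : ℝ) ≠ 0 := by exact_mod_cast hn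
    push_cast
    rw [zero_mul, zero_mul, Real.sin_zero, mul_assoc (n : ℝ) μ, mul_assoc (n : ℝ) μ]
    field_simp
    ring

/-- The wave numbers of the defect in `x`. -/
def defectX (i : ℤ × ℤ) : ℤ := i.2 - i.1

/-- The wave numbers of the defect in `y`. -/
def defectY (i : ℤ × ℤ) : ℤ := i.1 + i.2

/-- With `w_xx = S - A`, `w_yy = S - 1` and `w_xy = -Z` the linear terms cancel: `(S - A)(S - 1) -
Z² + S - A = (S + Z)(S - Z) - AS`. The factors `S ± Z` are the ridge sums in `ξ` and `η`, and `S` is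
their mean. -/
theorem bracket_pattern_add_dxx (hN : 0 < N) (hμ : μ ≠ 0) (p : ℝ × ℝ) :
    bracket (pattern hε N μ) (pattern hε N μ) p + (pattern hε N μ).dxx p =
      ∑ i ∈ waves N ×ˢ waves N, defect N i.1 i.2 *
        (Real.cos (defectX i * μ * p.1) * Real.cos (defectY i * μ * p.2)) := by
  have h1 := sum_defect_cos_mul_cos N (μ * p.1) (μ * p.2)
  rw [sum_defect hN] at h1
  simp only [defectX, defectY, mul_assoc _ μ]
  rw [waves, h1, ← waves]
  simp only [bracket, pattern_dxx hε hμ, pattern_dyy hε hμ, pattern_dxy hε hμ]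
  set Z := ∑ n ∈ waves N, ridge N n * (Real.sin (n * (μ * p.1)) * Real.sin (n * (μ * p.2)))
    with hZ
  have e1 : ∑ n ∈ waves N, ridge N n * Real.cos (n * (μ * p.2 - μ * p.1)) =
      obliqueSum N (μ * p.1) (μ * p.2) + Z := by
    rw [hZ, obliqueSum, ← Finset.sum_add_distrib]
    refine Finset.sum_congr rfl fun n _ => ?_
    rw [mul_sub, Real.cos_sub]; ring
  have e2 : ∑ n ∈ waves N, ridge N n * Real.cos (n * (μ * p.1 + μ * p.2)) =
      obliqueSum N (μ * p.1) (μ * p.2) - Z := by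
    rw [hZ, obliqueSum, ← Finset.sum_sub_distrib]
    refine Finset.sum_congr rfl fun n _ => ?_
    rw [mul_add, Real.cos_add]; ring
  have e3 : ∑ n ∈ waves N, ridge N n ^ 2 *
      Real.cos (n * (μ * p.1 + μ * p.2 - (μ * p.2 - μ * p.1))) = hoopSum N (μ * p.1) := by
    rw [hoopSum]
    refine Finset.sum_congr rfl fun n _ => ?_
    congr 3; ring
  rw [e1, e2, e3]
  ring

variable (N μ) in
/-- The Airy stress function of the pattern. -/
noncomputable def stress : SobolevH2 (Omega ε) :=
  cosSum hε (waves N ×ˢ waves N)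
    (fun i => -(defect N i.1 i.2 / ((defectX i * μ) ^ 2 + (defectY i * μ) ^ 2) ^ 2))
    (fun i => defectX i * μ) (fun i => defectY i * μ)

theorem defectX_sq_add_pos {i : ℤ × ℤ} (hμ : μ ≠ 0) (hi : i ≠ 0) :
    0 < (defectX i * μ : ℝ) ^ 2 + (defectY i * μ) ^ 2 := by
  have h0 : defectX i ≠ 0 ∨ defectY i ≠ 0 := by
    by_contra h
    rw [not_or, not_not, not_not] at h
    refine hi (Prod.ext ?_ ?_) <;> simp only [defectX, defectY, Prod.fst_zero, Prod.snd_zero] at *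
      <;> omega
  rcases h0 with h | h
  · have : (defectX i * μ : ℝ) ≠ 0 := mul_ne_zero (by exact_mod_cast h) hμ
    positivity
  · have : (defectY i * μ : ℝ) ≠ 0 := mul_ne_zero (by exact_mod_cast h) hμ
    positivity

/-- This is the solvability condition of the Airy equation: the right-hand side has no constant
mode. -/
theorem defect_zero (N : ℕ) : defect N 0 0 = 0 := by
  rw [defect, add_zero, ridge_zero]; norm_num

theorem isAiryStress_stress (hN : 0 < N) (hμ : μ ≠ 0)
    (hs : ∀ n : ℤ, Real.sin (n * μ * (side ε / 2)) = 0) :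
    IsAiryStress (pattern hε N μ) (stress hε N μ) := by
  refine isAiryStress_cosSum hε _ _ (fun i => defect N i.1 i.2) (fun i => defectX i * μ)
    (fun i => defectY i * μ) (fun i => hs _) (fun i => hs _) (fun i _ => ?_) fun p => ?_
  swap
  · exact bracket_pattern_add_dxx hε hN hμ p
  by_cases hi : i = 0
  · simp [hi, defect_zero]
  · have h0 := (defectX_sq_add_pos hμ hi).ne'
    generalize (defectX i * μ : ℝ) ^ 2 + (defectY i * μ) ^ 2 = d at h0
    field_simp

theorem memX_pattern (hμ : μ ≠ 0) (hs : ∀ n : ℤ, Real.sin (n * μ * (side ε / 2)) = 0) :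
    MemX (pattern hε N μ) := by
  refine ⟨zeroSlopeAtEnds_cosSum hε _ _ _ _ fun i => hs _,
    periodicInY_cosSum hε _ _ _ _ fun i => hs _, ?_⟩
  simp only [pattern, cosSum]
  rw [integral_finsetSum _ fun i _ => Continuous.integrableOn_Omega (by fun_prop)]
  refine Finset.sum_eq_zero fun i _ => ?_
  rw [integral_const_mul, integral_cos_mul_cos hε hμ hs]
  rcases i with n | n <;> by_cases hn : n = 0 <;> simp [amplitude, waveX, waveY, hn]

/-! ### Bounds for the stretching, bending and shortening of the pattern -/

theorem card_waves_le (hN : 0 < N) : ((waves N).card : ℝ) ≤ 5 * N := by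
  have : (waves N).card ≤ 5 * N := by rw [waves, Int.card_Icc]; omega
  exact_mod_cast this

/-- The wave number `n + m` that makes the defect small also bounds the symbol of the Laplacian from
below by `(n + m)²μ²`. Each coefficient of `Δφ` is thus at most `3/(μ²N²)`, and there are at most
`25N²` of them. -/
theorem integral_lap_stress_sq_le (hN : 0 < N) (hμ : μ ≠ 0)
    (hs : ∀ n : ℤ, Real.sin (n * μ * (side ε / 2)) = 0) :
    ∫ p in Omega ε, (stress hε N μ).lap p ^ 2 ≤ side ε ^ 2 * (225 / (μ ^ 4 * N ^ 2)) := by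
  have hN' : (0 : ℝ) < N := by exact_mod_cast hN
  simp only [stress, lap_cosSum]
  refine (integral_sum_cos_mul_cos_sq_le hε hμ hs _ _ defectX defectY ?_).trans ?_
  · rintro ⟨a, b⟩ _ ⟨c, d⟩ _ h h'
    simp only [defectX, defectY] at h h'
    ext <;> simp only <;> omega
  refine mul_le_mul_of_nonneg_left ?_ (sq_nonneg _)
  have key : ∀ i ∈ waves N ×ˢ waves N, (-((defectX i * μ) ^ 2 + (defectY i * μ) ^ 2) *
      -(defect N i.1 i.2 / ((defectX i * μ) ^ 2 + (defectY i * μ) ^ 2) ^ 2)) ^ 2 ≤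
      (3 / (μ ^ 2 * N ^ 2)) ^ 2 := by
    intro i _
    by_cases hi : i = 0
    · simp [hi, defect_zero]; positivity
    · have h0 := defectX_sq_add_pos hμ hi
      set d := (defectX i * μ : ℝ) ^ 2 + (defectY i * μ) ^ 2 with hd
      have e : -d * -(defect N i.1 i.2 / d ^ 2) = defect N i.1 i.2 / d := by
        field_simp
      rw [e, ← sq_abs]
      gcongr
      rw [abs_div, abs_of_pos h0, div_le_div_iff₀ h0 (by positivity)]
      calc |defect N i.1 i.2| * (μ ^ 2 * N ^ 2)
          ≤ 3 * ((i.1 + i.2 : ℤ) : ℝ) ^ 2 / (N : ℝ) ^ 2 * (μ ^ 2 * N ^ 2) := by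
            gcongr; exact abs_defect_le hN _ _
        _ = 3 * (defectY i * μ) ^ 2 := by rw [defectY]; field_simp
        _ ≤ 3 * d := by rw [hd]; nlinarith [sq_nonneg (defectX i * μ : ℝ)]
  refine (Finset.sum_le_card_nsmul _ _ _ key).trans ?_
  rw [Finset.card_product, nsmul_eq_mul, Nat.cast_mul]
  have hc := card_waves_le hN
  calc _ ≤ (5 * N) * (5 * N) * (3 / (μ ^ 2 * N ^ 2)) ^ 2 := by gcongr
    _ = 225 / (μ ^ 4 * N ^ 2) := by field_simp; norm_num

/-- Curvature of order `N` on a fraction `1/N` of the area gives order `N`; in Fourier terms, at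
most `5N` coefficients bounded by 1. -/
theorem integral_lap_pattern_sq_le (hN : 0 < N) (hμ : μ ≠ 0)
    (hs : ∀ n : ℤ, Real.sin (n * μ * (side ε / 2)) = 0) :
    ∫ p in Omega ε, (pattern hε N μ).lap p ^ 2 ≤ side ε ^ 2 * (80 * N) := by
  have hN' : (1 : ℝ) ≤ N := by exact_mod_cast hN
  have hc := card_waves_le hN
  have b1 : ∀ n, ridge N n ^ 2 ≤ 1 := fun n => pow_le_one₀ (ridge_nonneg N n) (ridge_le_one N n)
  have b2 : ∀ n, (ridge N n ^ 2) ^ 2 ≤ 1 := fun n => pow_le_one₀ (sq_nonneg _) (b1 n)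
  have h1 : ∫ p in Omega ε, obliqueSum N (μ * p.1) (μ * p.2) ^ 2 ≤ side ε ^ 2 * (5 * N) := by
    have := integral_sum_cos_mul_cos_sq_le hε hμ hs (waves N) (ridge N) (fun n => n) (fun n => n)
      fun i _ j _ h _ => h
    simp only [mul_assoc _ μ] at this
    refine this.trans (mul_le_mul_of_nonneg_left (le_trans ?_ hc) (sq_nonneg _))
    refine (Finset.sum_le_card_nsmul _ _ 1 fun n _ => b1 n).trans (by simp)
  have h2 : ∫ p in Omega ε, hoopSum N (μ * p.1) ^ 2 ≤ side ε ^ 2 * (5 * N) := by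
    have := integral_sum_cos_mul_cos_sq_le hε hμ hs (waves N) (fun n => ridge N n ^ 2)
      (fun n => 2 * n) (fun n => 0) fun i _ j _ h _ => by simpa using h
    have e : ∀ (n : ℤ) (p : ℝ × ℝ), Real.cos ((2 * n : ℤ) * μ * p.1) *
        Real.cos ((0 : ℤ) * μ * p.2) = Real.cos (n * (2 * (μ * p.1))) := fun n p => by
      push_cast
      rw [zero_mul, zero_mul, Real.cos_zero, mul_one]
      congr 1; ring
    simp only [e] at this
    refine this.trans (mul_le_mul_of_nonneg_left (le_trans ?_ hc) (sq_nonneg _))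
    refine (Finset.sum_le_card_nsmul _ _ 1 fun n _ => b2 n).trans (by simp)
  have h3 : ∫ p in Omega ε, (1 : ℝ) = side ε ^ 2 := by
    have := integral_cos_mul_cos hε hμ hs 0 0
    simpa using this
  have c1 : Continuous fun p : ℝ × ℝ => obliqueSum N (μ * p.1) (μ * p.2) := by
    unfold obliqueSum; fun_prop
  have c2 : Continuous fun p : ℝ × ℝ => hoopSum N (μ * p.1) := by
    unfold hoopSum; fun_prop
  -- From `(2S - A - 1)² ≤ 3(4S² + A² + 1)`. In total `75N + 3 ≤ 80N`.
  have h4 : ∫ p in Omega ε, (pattern hε N μ).lap p ^ 2 ≤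
      ∫ p in Omega ε, (12 * obliqueSum N (μ * p.1) (μ * p.2) ^ 2 +
        (3 * hoopSum N (μ * p.1) ^ 2 + 3 * 1)) := by
    simp only [SobolevH2.lap, pattern_dxx hε hμ, pattern_dyy hε hμ]
    refine setIntegral_mono (Continuous.integrableOn_Omega (by fun_prop))
      (Continuous.integrableOn_Omega (by fun_prop)) fun p => ?_
    simp only
    set S := obliqueSum N (μ * p.1) (μ * p.2)
    set A := hoopSum N (μ * p.1)
    nlinarith [sq_nonneg (2 * S + A), sq_nonneg (2 * S + 1), sq_nonneg (A - 1)]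
  rw [integral_add (Continuous.integrableOn_Omega (by fun_prop))
    (Continuous.integrableOn_Omega (by fun_prop)),
    integral_add (Continuous.integrableOn_Omega (by fun_prop))
    (Continuous.integrableOn_Omega (by fun_prop)), integral_const_mul, integral_const_mul,
    integral_const_mul, h3] at h4
  nlinarith [mul_le_mul_of_nonneg_left hN' (sq_nonneg (side ε))]

theorem integral_sin_mul_cos_mul {ε : ℝ} (hε : 0 < ε) {μ : ℝ} (hμ : μ ≠ 0)
    (hs : ∀ n : ℤ, Real.sin (n * μ * (side ε / 2)) = 0) (p q : ℤ) :
    ∫ z in Omega ε, (Real.sin (p * μ * z.1) * Real.cos (q * μ * z.2)) *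
        (Real.sin (μ * z.1) * Real.cos (μ * z.2)) =
      side ε ^ 2 / 4 * (((if p = 1 then 1 else 0) - if p = -1 then 1 else 0) *
        ((if q = 1 then 1 else 0) + if q = -1 then 1 else 0)) := by
  have e : ∀ z : ℝ × ℝ, (Real.sin (p * μ * z.1) * Real.cos (q * μ * z.2)) *
        (Real.sin (μ * z.1) * Real.cos (μ * z.2)) =
      1 / 4 * ((Real.cos ((p - 1 : ℤ) * μ * z.1) * Real.cos ((q - 1 : ℤ) * μ * z.2) +
        Real.cos ((p - 1 : ℤ) * μ * z.1) * Real.cos ((q + 1 : ℤ) * μ * z.2)) -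
        (Real.cos ((p + 1 : ℤ) * μ * z.1) * Real.cos ((q - 1 : ℤ) * μ * z.2) +
        Real.cos ((p + 1 : ℤ) * μ * z.1) * Real.cos ((q + 1 : ℤ) * μ * z.2))) := by
    intro z
    push_cast
    simp only [sub_mul, add_mul, one_mul, Real.cos_sub, Real.cos_add]
    ring
  simp only [e]
  rw [integral_const_mul, integral_sub (Continuous.integrableOn_Omega (by fun_prop))
    (Continuous.integrableOn_Omega (by fun_prop)),
    integral_add (Continuous.integrableOn_Omega (by fun_prop))
    (Continuous.integrableOn_Omega (by fun_prop)),
    integral_add (Continuous.integrableOn_Omega (by fun_prop))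
    (Continuous.integrableOn_Omega (by fun_prop))]
  simp only [integral_cos_mul_cos hε hμ hs, sub_eq_zero, add_eq_zero_iff_eq_neg]
  by_cases h1 : p = 1 <;> by_cases h2 : p = -1 <;> by_cases h3 : q = 1 <;> by_cases h4 : q = -1 <;>
    simp [h1, h2, h3, h4] <;> first | omega | ring

/-- The projection of `w_x` on the lowest oblique mode already suffices. Only `n = ±1` of the
oblique family contributes to it; the hoop family has wave number 0 in `y`. -/
theorem le_integral_pattern_dx_sq (hN : 2 ≤ N) (hμ : μ ≠ 0)
    (hs : ∀ n : ℤ, Real.sin (n * μ * (side ε / 2)) = 0) :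
    side ε ^ 2 / (2 * μ ^ 2) ≤ ∫ p in Omega ε, (pattern hε N μ).dx p ^ 2 := by
  have h1 : ∫ p in Omega ε, (pattern hε N μ).dx p * (Real.sin (μ * p.1) * Real.cos (μ * p.2)) =
      side ε ^ 2 * ridge N 1 / (2 * μ) := by
    have e : ∀ p : ℝ × ℝ, (pattern hε N μ).dx p * (Real.sin (μ * p.1) * Real.cos (μ * p.2)) =
        ∑ i ∈ (waves N).disjSum (waves N), amplitude N μ i * (-(waveX i * μ)) *
          ((Real.sin (waveX i * μ * p.1) * Real.cos (waveY i * μ * p.2)) *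
            (Real.sin (μ * p.1) * Real.cos (μ * p.2))) := fun p => by
      simp only [pattern, cosSum]
      rw [Finset.sum_mul]
      exact Finset.sum_congr rfl fun i _ => by ring
    simp only [e]
    rw [integral_finsetSum _ fun i _ => Continuous.integrableOn_Omega (by fun_prop)]
    simp only [integral_const_mul, integral_sin_mul_cos_mul hε hμ hs]
    rw [Finset.sum_disjSum]
    simp only [amplitude, waveX, waveY, Sum.elim_inl, Sum.elim_inr]
    have m1 : (1 : ℤ) ∈ waves N := by rw [waves, Finset.mem_Icc]; omega
    have m2 : (-1 : ℤ) ∈ (waves N).erase 1 := by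
      rw [Finset.mem_erase, waves, Finset.mem_Icc]; omega
    rw [← Finset.add_sum_erase _ _ m1, ← Finset.add_sum_erase _ _ m2,
      Finset.sum_eq_zero (s := ((waves N).erase 1).erase (-1)) fun n hn => by
        rw [Finset.mem_erase, Finset.mem_erase] at hn
        simp [hn.1, hn.2.1]]
    simp [ridge_neg]
    field_simp
    ring
  have h2 : ∫ p in Omega ε, (Real.sin (μ * p.1) * Real.cos (μ * p.2)) ^ 2 = side ε ^ 2 / 4 := by
    have := integral_sin_mul_cos_mul hε hμ hs 1 1
    simpa [sq] using this
  have c1 : Continuous (pattern hε N μ).dx := by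
    simp only [pattern, cosSum]; fun_prop
  -- The coefficient of the projection, which makes the following square optimal.
  set t := 2 * ridge N 1 / μ with ht
  have h3 : 0 ≤ ∫ p in Omega ε, ((pattern hε N μ).dx p ^ 2 +
      (-(2 * t) * ((pattern hε N μ).dx p * (Real.sin (μ * p.1) * Real.cos (μ * p.2))) +
        t ^ 2 * (Real.sin (μ * p.1) * Real.cos (μ * p.2)) ^ 2)) := by
    refine integral_nonneg fun p => ?_
    simp only [Pi.zero_apply]
    nlinarith [sq_nonneg ((pattern hε N μ).dx p - t * (Real.sin (μ * p.1) * Real.cos (μ * p.2)))]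
  rw [integral_add (Continuous.integrableOn_Omega (by fun_prop))
    (Continuous.integrableOn_Omega (by fun_prop)),
    integral_add (Continuous.integrableOn_Omega (by fun_prop))
    (Continuous.integrableOn_Omega (by fun_prop)), integral_const_mul, integral_const_mul,
    h1, h2] at h3
  have h4 : -(2 * t) * (side ε ^ 2 * ridge N 1 / (2 * μ)) + t ^ 2 * (side ε ^ 2 / 4) =
      -(side ε ^ 2 / (2 * μ ^ 2) * (2 * ridge N 1 ^ 2)) := by
    rw [ht]; field_simp; ring
  have h5 : 1 ≤ 2 * ridge N 1 ^ 2 := by nlinarith [ridge_one_ge hN]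
  have h6 : 0 ≤ side ε ^ 2 / (2 * μ ^ 2) := by positivity
  nlinarith

end Pattern

/-! ### The total potential of the pattern -/

theorem totalPotential_pattern_neg {ε : ℝ} (hε : 0 < ε) {N : ℕ} {μ lam : ℝ} (hN : 2 ≤ N)
    (hμ : μ ≠ 0) (hs : ∀ n : ℤ, Real.sin (n * μ * (side ε / 2)) = 0) (hlam : 0 < lam)
    (h : 80 * N + 225 / (μ ^ 4 * N ^ 2) < lam / (2 * μ ^ 2)) :
    totalPotential lam (pattern hε N μ) < 0 := by
  have hN' : 0 < N := by omega
  have h1 := integral_lap_pattern_sq_le hε hN' hμ hs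
  have h2 := integral_lap_stress_sq_le hε hN' hμ hs
  have h3 := mul_le_mul_of_nonneg_left (le_integral_pattern_dx_sq hε hN hμ hs) hlam.le
  have h4 : side ε ^ 2 * (80 * N + 225 / (μ ^ 4 * N ^ 2)) < side ε ^ 2 * (lam / (2 * μ ^ 2)) :=
    mul_lt_mul_of_pos_left h (pow_pos (side_pos hε) 2)
  rw [totalPotential, storedEnergy, shortening, stretching_eq (isAiryStress_stress hε hN' hμ hs)]
  have h5 : lam * (side ε ^ 2 / (2 * μ ^ 2)) = side ε ^ 2 * (lam / (2 * μ ^ 2)) := by ring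
  linarith

/-- A wave number of the periodic rectangle in a prescribed octave. -/
theorem exists_wave_number {ε τ : ℝ} (hε : 0 < ε) (hτ : 0 < τ) (h : 2 * Real.pi * τ ≤ side ε) :
    ∃ μ : ℝ, 0 < μ ∧ (∀ n : ℤ, Real.sin (n * μ * (side ε / 2)) = 0) ∧ τ ≤ μ⁻¹ ∧ μ⁻¹ ≤ 2 * τ := by
  have hs := side_pos hε
  have hπ := Real.pi_pos
  set r := side ε / (2 * Real.pi * τ) with hr
  have hr1 : 1 ≤ r := by rw [hr, le_div_iff₀ (by positivity)]; linarith
  -- The number of periods of the pattern along a side. Rounding down costs at most a factor 2,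
  -- since `r ≥ 1`.
  set k := ⌊r⌋₊ with hk
  have hk1 : 1 ≤ k := Nat.one_le_floor_iff r |>.2 hr1
  have hk1' : (1 : ℝ) ≤ k := by exact_mod_cast hk1
  have hk2 : (k : ℝ) ≤ r := Nat.floor_le (by linarith)
  have hk3 : r < k + 1 := Nat.lt_floor_add_one r
  have e : (2 * Real.pi * k / side ε)⁻¹ = τ * (r / k) := by
    rw [hr]; field_simp
  refine ⟨2 * Real.pi * k / side ε, by positivity, fun n => ?_, ?_, ?_⟩
  · rw [show n * (2 * Real.pi * k / side ε) * (side ε / 2) = ((n * k : ℤ) : ℝ) * Real.pi by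
      push_cast; field_simp]
    exact Real.sin_int_mul_pi _
  · rw [e]
    exact le_mul_of_one_le_right hτ.le ((one_le_div (by positivity)).2 hk2)
  · rw [e, mul_comm 2]
    refine mul_le_mul_of_nonneg_left ?_ hτ.le
    rw [div_le_iff₀ (by positivity)]; linarith

theorem exists_totalPotential_neg (lam : ℝ) (hlam : 0 < lam) : ∃ ε₀ : ℝ, 0 < ε₀ ∧
    ∀ ε : ℝ, 0 < ε → ε < ε₀ → ∃ w : SobolevH2 (Omega ε), MemX w ∧ (∃ φ, IsAiryStress w φ) ∧
      totalPotential lam w < 0 := by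
  -- The constant is `2 · 3680`, where `3680 = 80 + 225 · 2⁴` collects bending and stretching below.
  obtain ⟨M, hM⟩ := exists_nat_gt (max 2 (7360 / lam))
  have hM2 : (2 : ℝ) < M := (le_max_left _ _).trans_lt hM
  have hM3 : 7360 < M * lam := by
    have := (le_max_right _ _).trans_lt hM
    rwa [div_lt_iff₀ hlam] at this
  have hM2' : 2 < M := by exact_mod_cast hM2
  have hπ := Real.pi_pos
  have hτ : (0 : ℝ) < (M : ℝ) ^ 3 := by positivity
  set L := 2 * Real.pi * (M : ℝ) ^ 3 with hL
  have hL0 : 0 < L := by positivity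
  -- For `ε ≤ L⁻²` the side `ε^{-1/2}` is at least `L`, so that a pattern with `1/μ` between `M³`
  -- and `2M³` fits.
  refine ⟨L ^ (-2 : ℝ), by positivity, fun ε hε hlt => ?_⟩
  have hside : L ≤ side ε := by
    have h1 : (L ^ (-2 : ℝ)) ^ (-(1 / 2) : ℝ) ≤ ε ^ (-(1 / 2) : ℝ) :=
      Real.rpow_le_rpow_of_nonpos hε hlt.le (by norm_num)
    rw [← Real.rpow_mul hL0.le] at h1
    norm_num at h1
    simpa [side] using h1
  obtain ⟨μ, hμ, hs, hμ1, hμ2⟩ := exists_wave_number hε hτ hside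
  have hN : 2 ≤ M ^ 4 := hM2'.le.trans (Nat.le_self_pow (by norm_num) M)
  -- The powers realise `N = u^{4/3}` in integers: with `u` of order `M³` and `N = M⁴`, both
  -- energies are of order `M⁴`, against a gain of order `λM⁶`.
  refine ⟨pattern hε (M ^ 4) μ, memX_pattern hε hμ.ne' hs,
    ⟨_, isAiryStress_stress hε (by omega) hμ.ne' hs⟩,
    totalPotential_pattern_neg hε hN hμ.ne' hs hlam ?_⟩
  push_cast
  set u := μ⁻¹ with hu
  have e1 : 225 / (μ ^ 4 * ((M : ℝ) ^ 4) ^ 2) = 225 * u ^ 4 / (M : ℝ) ^ 8 := by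
    rw [hu]; field_simp
  have e2 : lam / (2 * μ ^ 2) = lam * u ^ 2 / 2 := by
    rw [hu]; field_simp
  rw [e1, e2]
  have hu0 : 0 < u := inv_pos.2 hμ
  calc 80 * (M : ℝ) ^ 4 + 225 * u ^ 4 / (M : ℝ) ^ 8
      ≤ 80 * (M : ℝ) ^ 4 + 225 * (2 * (M : ℝ) ^ 3) ^ 4 / (M : ℝ) ^ 8 := by gcongr
    _ = 3680 * (M : ℝ) ^ 4 := by field_simp; ring
    _ < (M * lam) / 2 * (M : ℝ) ^ 4 := by gcongr; linarith
    _ ≤ (M * lam) / 2 * (M : ℝ) ^ 5 := by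
      gcongr
      · linarith
      · norm_num
    _ = lam * ((M : ℝ) ^ 3) ^ 2 / 2 := by ring
    _ ≤ lam * u ^ 2 / 2 := by gcongr

end VKD

theorem corollary3p3 :
    (∀ lam : ℝ, 0 < lam → ∃ ε₀ : ℝ, 0 < ε₀ ∧ ∀ ε : ℝ, 0 < ε → ε < ε₀ →
      ∃ w : VKD.SobolevH2 (VKD.Omega ε), VKD.MemX w ∧ (∃ φ, VKD.IsAiryStress w φ) ∧
        VKD.totalPotential lam w < 0) ∧
    (∃ ε₀ : ℝ, 0 < ε₀ ∧ ∀ ε : ℝ, 0 < ε → ε < ε₀ →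
      ∃ lam₀ : ℝ, 0 ≤ lam₀ ∧ lam₀ < 2 ∧ ∀ lam : ℝ, lam₀ < lam →
        ∃ w : VKD.SobolevH2 (VKD.Omega ε), VKD.MemX w ∧ (∃ φ, VKD.IsAiryStress w φ) ∧
          VKD.totalPotential lam w < 0) := by
  refine ⟨VKD.exists_totalPotential_neg, ?_⟩
  obtain ⟨ε₀, h0, h⟩ := VKD.exists_totalPotential_neg 1 one_pos
  -- Any fixed positive load below 2 would serve. The state found at load 1 keeps a negative
  -- potential at larger loads because the shortening is nonnegative.
  refine ⟨ε₀, h0, fun ε hε hlt => ⟨1, zero_le_one, one_lt_two, fun lam hlam => ?_⟩⟩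
  obtain ⟨w, hw, hφ, hneg⟩ := h ε hε hlt
  refine ⟨w, hw, hφ, lt_of_le_of_lt ?_ hneg⟩
  have hS : 0 ≤ VKD.shortening w :=
    mul_nonneg (by norm_num) (integral_nonneg fun p => sq_nonneg _)
  exact sub_le_sub_left (mul_le_mul_of_nonneg_right hlam.le hS) _
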